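/- Fix integers $d\ge 1$, $k\ge 0$ and a noise level $\sigma>0$, and put $s=(k+1)/d$. For $N\ge 1$ let $n=N^d$, and index vectors in $\mathbb{R}^n$ by the lattice $[N]^d$, where $[m]=\{1,\dots,m\}$. Let $D_m\in\mathbb{R}^{(m-1)\times m}$ be the first difference matrix, $(D_m\theta)_i=\theta_{i+1}-\theta_i$, let $D_N^{(0)}=I_N$ and $D^{(r+1)}_N=D_{N-r}D^{(r)}_N$, and let $\mathbf{D}$ be the matrix obtained by stacking the $d$ blocks $I_N\otimes\cdots\otimes D_N^{(k+1)}\otimes\cdots\otimes I_N$, with $D^{(k+1)}_N$ in position $j=1,\dots,d$. The discrete Sobolev class of radius $B>0$ is $$\mathcal W^{k+1}_{n,d}(B)=\{\theta\in\mathbb{R}^n:\ \|\mathbf{D}\theta\|_2\le B\}.$$ For $K\subseteq\mathbb{R}^n$ let $R(K)=\inf_{\hat\theta}\sup_{\theta\in K}\frac1n\mathbb{E}\|\hat\theta(y)-\theta\|_2^2$ be the minimax risk, where $y_x\sim N(\theta_x,\sigma^2)$ independently and the infimum is over all estimators. Let $\zeta_1\le\cdots\le\zeta_N$ be the square roots of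 the eigenvalues of $(D_N^{(k+1)})^{\mathsf T}D_N^{(k+1)}$, with multiplicity. The right singular vectors of $\mathbf{D}$ are indexed by $i\in[N]^d$ so that $(v_i)$ is an orthonormal basis of $\mathbb{R}^n$ and $v_i$ has singular value $\xi_i=(\zeta_{i_1}^2+\cdots+\zeta_{i_d}^2)^{1/2}$. For $Q\subseteq[N]^d$ the eigenmaps projection estimator is $\hat\theta=V_QV_Q^{\mathsf T}y$, where $V_Q$ has the columns $v_i$, $i\in Q$. (i) There are constants $c,C>0$ depending only on $k,d,\sigma$ such that for all $N\ge 1$ and all $0<B_n\le\sqrt n$, $$c\left(\frac1n+\Big(\frac{B_n^2}{n}\Big)^{\frac1{2s+1}}\right)\le R\big(\mathcal W^{k+1}_{n,d}(B_n)\big)\le C\left(\frac1n+\Big(\frac{B_n^2}{n}\Big)^{\frac1{2s+1}}\right).$$ (ii) The upper bound is achieved by the eigenmaps projection estimator with $Q=[\tau]^d$ and $\tau^d\asymp 1+(B_n^2n^{2s})^{1/(2s+1)}$: for all $c_1,c_2>0$ there is $C>0$, depending only on $k,d,\sigma,c_1,c_2$, such that for all $N\ge1$, all $0<B_n\le\sqrt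 n$ and all integers $\tau$ with $\min(k+1,N)\le\tau\le N$ and $c_1\le\tau^d/\big(1+(B_n^2n^{2s})^{1/(2s+1)}\big)\le c_2$, every such estimator satisfies $$\sup_{\theta\in\mathcal W^{k+1}_{n,d}(B_n)}\frac1n\mathbb{E}\|\hat\theta-\theta\|_2^2\le C\left(\frac1n+\Big(\frac{B_n^2}{n}\Big)^{\frac1{2s+1}}\right).$$ Moreover, for suitable $c_1,c_2>0$ depending only on $k,d$, such $\tau$ and $(v_i)$ exist for all $N\ge1$ and all $0<B_n\le\sqrt n$. (iii) Under the canonical scaling $B_n\asymp n^{1/2-s}$ the minimax risk is of order $n^{-2s/(2s+1)}$: for all $a,b>0$ there are $c,C>0$, depending only on $k,d,\sigma,a,b$, such that for all $N\ge1$ and all $B_n$ with $a\,n^{1/2-s}\le B_n\le b\,n^{1/2-s}$, $$c\,n^{-\frac{2s}{2s+1}}\le R\big(\mathcal W^{k+1}_{n,d}(B_n)\big)\le C\,n^{-\frac{2s}{2s+1}}.$$ -/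

import Mathlib

open MeasureTheory ProbabilityTheory
open scoped NNReal ENNReal Matrix

noncomputable section

namespace KroneckerTF

/-! ### Minimax risk in the Gaussian sequence model -/

section Risk

variable {ι : Type*} [Fintype ι]

/-- The law of the data `y`: independent coordinates `y x ∼ N(θ x, σ²)`. -/
def dataLaw (σ : ℝ≥0) (θ : ι → ℝ) : Measure (ι → ℝ) :=
  Measure.pi fun x => gaussianReal (θ x) (σ ^ 2)

/-- The worst-case risk over `K` of an estimator `est`:
`sup_{θ ∈ K} (1/n) E ‖est y - θ‖₂²`, with `n` the number of coordinates; the value is in `[0, ∞]`. -/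
def maxRisk (σ : ℝ≥0) (K : Set (ι → ℝ)) (est : (ι → ℝ) → (ι → ℝ)) : ℝ≥0∞ :=
  ⨆ θ ∈ K,
    (∫⁻ y, ENNReal.ofReal (‖WithLp.toLp 2 (est y - θ)‖ ^ 2) ∂(dataLaw σ θ)) /
      (Fintype.card ι : ℝ≥0∞)

/-- The minimax risk over `K`: the infimum of the worst-case risk over all (measurable)
estimators. -/
def minimaxRisk (σ : ℝ≥0) (K : Set (ι → ℝ)) : ℝ≥0∞ :=
  ⨅ (est : (ι → ℝ) → (ι → ℝ)) (_ : Measurable est), maxRisk σ K est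

end Risk

/-! ### The Kronecker difference operator and the discrete Sobolev class -/

/-- The `(m-1) × m` first difference matrix: row `i` has `-1` in column `i` and `1` in
column `i + 1`. -/
def firstDiff (m : ℕ) : Matrix (Fin (m - 1)) (Fin m) ℝ :=
  Matrix.of fun i j =>
    if (j : ℕ) = (i : ℕ) then -1 else if (j : ℕ) = (i : ℕ) + 1 then 1 else 0

/-- The `(N-r) × N` difference matrix of order `r`: `D⁽⁰⁾ = I` and
`D⁽ʳ⁺¹⁾ = D_{N-r} D⁽ʳ⁾`. It has no rows if `N ≤ r`. -/
def diffMat (N : ℕ) : (r : ℕ) → Matrix (Fin (N - r)) (Fin N) ℝ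
  | 0 => (1 : Matrix (Fin N) (Fin N) ℝ)
  | r + 1 => firstDiff (N - r) * diffMat N r

/-- The lattice with `N` points on each of the `d` axes, so `n = N ^ d` points. -/
abbrev Lattice (d N : ℕ) : Type := Fin d → Fin N

/-- The order of differencing, along axis `i`, in the `j`-th block of the Kronecker matrix. -/
abbrev blockOrder {d : ℕ} (k : ℕ) (j i : Fin d) : ℕ := if i = j then k + 1 else 0

/-- The rows of the Kronecker matrix: a block index `j`, and a row index for each of the `d`
factors of the `j`-th block. -/
abbrev RowIndex (d k N : ℕ) : Type := (j : Fin d) × ((i : Fin d) → Fin (N - blockOrder k j i))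

/-- The Kronecker difference matrix: the blocks `I ⊗ ⋯ ⊗ D⁽ᵏ⁺¹⁾ ⊗ ⋯ ⊗ I` (with `D⁽ᵏ⁺¹⁾` in
position `j`), `j = 1, …, d`, on top of each other; note that `diffMat N 0` is the identity. -/
def kronMat (d k N : ℕ) : Matrix (RowIndex d k N) (Lattice d N) ℝ :=
  Matrix.of fun r x => ∏ i, diffMat N (blockOrder k r.1 i) (r.2 i) (x i)

/-- The discrete Sobolev class of order `k + 1` and radius `ρ`. -/
def sobolevClass (d k N : ℕ) (ρ : ℝ) : Set (Lattice d N → ℝ) :=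
  {θ | ‖WithLp.toLp 2 (kronMat d k N *ᵥ θ)‖ ≤ ρ}

/-! ### The eigenmaps projection estimator -/

/-- `v` is an orthonormal basis of right singular vectors of `M`, with singular values `ξ`
(zeros included, so that there are as many as columns of `M`). -/
structure IsRightSingularSystem {m ι : Type*} [Fintype m] [Fintype ι] [DecidableEq ι]
    (M : Matrix m ι ℝ) (ξ : ι → ℝ) (v : ι → ι → ℝ) : Prop where
  nonneg : ∀ i, 0 ≤ ξ i
  orthonormal : ∀ i j, v i ⬝ᵥ v j = if i = j then 1 else 0
  gram : ∀ i, (Mᵀ * M) *ᵥ v i = (ξ i ^ 2) • v i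

/-- Singular values `ξ` and right singular vectors `v` of the Kronecker matrix, indexed by
multi-indices in `[N]^d` in increasing order along each dimension. The Gram matrix of the Kronecker
matrix is the Kronecker sum of `d` copies of the Gram matrix of `D⁽ᵏ⁺¹⁾`; hence the multi-index
`i` carries the singular value `√(∑ⱼ ζ_{iⱼ}²)`, with `ζ₁ ≤ ⋯ ≤ ζ_N` the singular values
of `D⁽ᵏ⁺¹⁾` (zeros included). -/
structure IsEigenmapsSystem (d k N : ℕ) (ξ : Lattice d N → ℝ)
    (v : Lattice d N → Lattice d N → ℝ) : Prop where
  system : IsRightSingularSystem (kronMat d k N) ξ v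
  sorted : ∃ (ζ : Fin N → ℝ) (w : Fin N → Fin N → ℝ),
    IsRightSingularSystem (diffMat N (k + 1)) ζ w ∧ Monotone ζ ∧
      ∀ i, ξ i = √(∑ j, ζ (i j) ^ 2)

/-- The index set `[τ]^d`. -/
def cube (d N τ : ℕ) : Finset (Lattice d N) :=
  Finset.univ.filter fun i => ∀ j, (i j : ℕ) < τ

/-- The matrix `V_Q` with columns `v i`, `i ∈ Q`. -/
def eigenmapsMatrix {d N : ℕ} (v : Lattice d N → Lattice d N → ℝ) (Q : Finset (Lattice d N)) :
    Matrix (Lattice d N) Q ℝ :=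
  Matrix.of fun x i => v i x

/-- The eigenmaps projection estimator `y ↦ V_Q V_Qᵀ y`. -/
def eigenmaps {d N : ℕ} (v : Lattice d N → Lattice d N → ℝ) (Q : Finset (Lattice d N)) :
    (Lattice d N → ℝ) → (Lattice d N → ℝ) :=
  fun y => (eigenmapsMatrix v Q * (eigenmapsMatrix v Q)ᵀ) *ᵥ y

/-! ### Rates -/

/-- The effective smoothness `s = (k+1)/d`. -/
def effSmooth (d k : ℕ) : ℝ := ((k : ℝ) + 1) / d

/-- The sample size `n = N ^ d`, as a real number. -/
def sampleSize (d N : ℕ) : ℝ := (N : ℝ) ^ d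

/-- `1/n + (B²/n)^(1/(2s+1))`. -/
def sobolevRate (d k N : ℕ) (B : ℝ) : ℝ :=
  1 / sampleSize d N + (B ^ 2 / sampleSize d N) ^ (1 / (2 * effSmooth d k + 1))

/-- `(B² n^(2s))^(1/(2s+1))`. -/
def cutoffSize (d k N : ℕ) (B : ℝ) : ℝ :=
  (B ^ 2 * sampleSize d N ^ (2 * effSmooth d k)) ^ (1 / (2 * effSmooth d k + 1))

/-- `τ` is an admissible cutoff, `τ^d ≍ 1 + (B² n^(2s))^(1/(2s+1))` with constants `c₁, c₂`:
it is at most `N`, and `[τ]^d` contains the `(k+1)^d` indices of the null space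
(all indices if `N ≤ k + 1`). -/
structure IsCutoff (d k N : ℕ) (B c₁ c₂ : ℝ) (τ : ℕ) : Prop where
  le_size : τ ≤ N
  null_le : min (k + 1) N ≤ τ
  lower : c₁ * (1 + cutoffSize d k N B) ≤ (τ : ℝ) ^ d
  upper : (τ : ℝ) ^ d ≤ c₂ * (1 + cutoffSize d k N B)

end KroneckerTF

end

noncomputable section

namespace KroneckerTF

/-! ### Singular systems and variational bounds for singular values -/

/-! In the basis `v` the Sobolev class is the ellipsoid `∑ ξ i ^ 2 * (v i ⬝ᵥ θ) ^ 2 ≤ B ^ 2`, and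
`ξ` is built from the one-dimensional singular values `ζ`. Everything therefore rests on `ζ_t ≍
(t/N)^(k+1)`, proved by variational arguments without diagonalising the difference matrix: a
blockwise Poincaré inequality gives the lower bound (`singularValue_diffMat_lower`), and a space of
disjoint smooth bumps the upper one (`exists_singularValue_diffMat_le`).

Let `T` be `cutoffSize`, so that `T^(2s+1) = B² n^(2s)`; the target rate is `(1 + T)/n`. Projecting
on `[τ]^d` costs variance `σ² τ^d` and squared bias at most `B²/ζ_τ²`. Both are of order `1 + T`
when `τ^d ≍ 1 + T` (`exists_maxRisk_eigenmaps_le`).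

For the lower bound, a hypercube with vertices `±σ` in the directions of `[M]^d` fits in the
ellipsoid as long as `σ² M^d · d · max_{t<M} ζ_t² ≤ B²`, which allows `M^d` of order `T`. Assouad's
argument (`minimaxRisk_ge_of_hypercube`) then gives risk of order `M^d/n`. When `T` is small, `M =
1` always works because the smallest singular value is zero; this yields the term `1/n`.

Under the canonical scaling the radius may exceed `√n`, but then `n` is bounded and the trivial
bound `σ²` suffices. -/

lemma norm_toLp_sq {ι : Type*} [Fintype ι] (u : ι → ℝ) :
    ‖WithLp.toLp 2 u‖ ^ 2 = u ⬝ᵥ u := by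
  rw [EuclideanSpace.real_norm_sq_eq]
  simp [dotProduct, sq]

lemma dotProduct_self_nonneg' {ι : Type*} [Fintype ι] (u : ι → ℝ) : 0 ≤ u ⬝ᵥ u := by
  rw [← norm_toLp_sq]; positivity

lemma dotProduct_self_pos {ι : Type*} [Fintype ι] {u : ι → ℝ} (hu : u ≠ 0) : 0 < u ⬝ᵥ u :=
  lt_of_le_of_ne (dotProduct_self_nonneg' u) fun h => hu (dotProduct_self_eq_zero.1 h.symm)

lemma mulVec_dotProduct_mulVec {m ι : Type*} [Fintype m] [Fintype ι] (M : Matrix m ι ℝ)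
    (u u' : ι → ℝ) : (M *ᵥ u) ⬝ᵥ (M *ᵥ u') = ((Mᵀ * M) *ᵥ u) ⬝ᵥ u' := by
  rw [Matrix.dotProduct_mulVec, ← Matrix.mulVec_mulVec, ← Matrix.mulVec_transpose]

/-- Parseval's identity for an orthonormal family with as many members as coordinates. -/
lemma dotProduct_eq_sum_of_orthonormal {ι : Type*} [Fintype ι] [DecidableEq ι] {v : ι → ι → ℝ}
    (hv : ∀ i j, v i ⬝ᵥ v j = if i = j then 1 else 0) (u u' : ι → ℝ) :
    u ⬝ᵥ u' = ∑ i, (v i ⬝ᵥ u) * (v i ⬝ᵥ u') := by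
  have h1 : Matrix.of v * (Matrix.of v)ᵀ = 1 := by
    ext i j
    simpa [Matrix.mul_apply, Matrix.one_apply, dotProduct] using hv i j
  have h2 := mul_eq_one_comm.1 h1
  have h3 := mulVec_dotProduct_mulVec (Matrix.of v) u u'
  rw [h2, Matrix.one_mulVec] at h3
  rw [← h3]
  simp [dotProduct, Matrix.mulVec]

section System

variable {m ι : Type*} [Fintype m] [Fintype ι] [DecidableEq ι] {M : Matrix m ι ℝ} {ξ : ι → ℝ}
  {v : ι → ι → ℝ}

/-- Parseval for `MᵀM u` against `u`, with the symmetric matrix moved onto `v i`. This is what turns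
the Sobolev ball into an ellipsoid. -/
lemma IsRightSingularSystem.mulVec_dotProduct_self (h : IsRightSingularSystem M ξ v)
    (u : ι → ℝ) : (M *ᵥ u) ⬝ᵥ (M *ᵥ u) = ∑ i, ξ i ^ 2 * (v i ⬝ᵥ u) ^ 2 := by
  rw [mulVec_dotProduct_mulVec, dotProduct_eq_sum_of_orthonormal h.orthonormal]
  refine Finset.sum_congr rfl fun i _ => ?_
  have : v i ⬝ᵥ ((Mᵀ * M) *ᵥ u) = ξ i ^ 2 * (v i ⬝ᵥ u) := by
    rw [← Matrix.mulVec_mulVec, dotProduct_comm, Matrix.mulVec_transpose,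
      ← Matrix.dotProduct_mulVec, dotProduct_comm, mulVec_dotProduct_mulVec, h.gram,
      smul_dotProduct, smul_eq_mul]
  rw [this]; ring

/-- The combination of the vectors `v i` with coefficients `a i`. -/
def combination (v : ι → ι → ℝ) (a : ι → ℝ) : ι → ℝ := ∑ i, a i • v i

lemma dotProduct_combination (hv : ∀ i j, v i ⬝ᵥ v j = if i = j then 1 else 0) (a : ι → ℝ)
    (i : ι) : v i ⬝ᵥ combination v a = a i := by
  simp [combination, dotProduct_sum, hv]

end System

/-- If `c ‖u‖² ≤ ‖M u‖²` on a subspace of codimension at most `t`, then `c ≤ ζ_t²`. -/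
lemma le_singularValue_sq {m : Type*} [Fintype m] {N : ℕ} {M : Matrix m (Fin N) ℝ}
    {ζ : Fin N → ℝ} {w : Fin N → Fin N → ℝ} (h : IsRightSingularSystem M ζ w)
    (hζ : Monotone ζ) {κ : Type*} [Fintype κ] (f : (Fin N → ℝ) →ₗ[ℝ] (κ → ℝ)) (t : Fin N)
    (hκ : Fintype.card κ ≤ t) (c : ℝ)
    (hc : ∀ u, f u = 0 → c * (u ⬝ᵥ u) ≤ (M *ᵥ u) ⬝ᵥ (M *ᵥ u)) : c ≤ ζ t ^ 2 := by
  -- `g` parametrises the span of the first `t + 1` singular vectors; its dimension exceeds the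
  -- number of conditions in `f`, so some nonzero `g a` satisfies them all.
  let g : (Finset.Iic t → ℝ) →ₗ[ℝ] (Fin N → ℝ) :=
    ∑ i : Finset.Iic t, (LinearMap.proj i).smulRight (w i)
  have hker : LinearMap.ker (f ∘ₗ g) ≠ ⊥ := by
    apply LinearMap.ker_ne_bot_of_finrank_lt
    simp only [Module.finrank_fintype_fun_eq_card, Fintype.card_coe, Fin.card_Iic]
    omega
  obtain ⟨a, ha, ha0⟩ := Submodule.exists_mem_ne_zero_of_ne_bot hker
  have hg : ∀ i : Fin N, w i ⬝ᵥ g a = if hi : i ∈ Finset.Iic t then a ⟨i, hi⟩ else 0 := by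
    intro i
    simp only [g, LinearMap.coe_sum, Finset.sum_apply, LinearMap.smulRight_apply,
      LinearMap.proj_apply, dotProduct_sum, dotProduct_smul, h.orthonormal, smul_eq_mul,
      mul_ite, mul_one, mul_zero]
    split_ifs with hi
    · rw [Finset.sum_eq_single ⟨i, hi⟩]
      · simp
      · intro b _ hb
        rw [if_neg]
        rintro rfl
        exact hb rfl
      · simp
    · refine Finset.sum_eq_zero fun b _ => ?_
      rw [if_neg]
      rintro rfl
      exact hi b.2
  have hu0 : g a ≠ 0 := by
    intro h0
    apply ha0
    ext ⟨i, hi⟩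
    have := hg i
    rw [h0, dif_pos hi] at this
    simpa using this.symm
  have h1 := hc (g a) (by simpa using ha)
  rw [h.mulVec_dotProduct_self] at h1
  have h2 : ∑ i, ζ i ^ 2 * (w i ⬝ᵥ g a) ^ 2 ≤ ζ t ^ 2 * (g a ⬝ᵥ g a) := by
    rw [dotProduct_eq_sum_of_orthonormal h.orthonormal (g a), Finset.mul_sum]
    refine Finset.sum_le_sum fun i _ => ?_
    rw [← sq]
    by_cases hi : i ∈ Finset.Iic t
    · have := h.nonneg i
      have := hζ (Finset.mem_Iic.1 hi)
      gcongr
    · rw [hg i, dif_neg hi]; simp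
  exact le_of_mul_le_mul_right (h1.trans h2) (dotProduct_self_pos hu0)

/-- If `‖M u‖² ≤ c ‖u‖²` on a subspace of dimension greater than `t`, then `ζ_t² ≤ c`. -/
lemma singularValue_sq_le {m : Type*} [Fintype m] {N : ℕ} {M : Matrix m (Fin N) ℝ}
    {ζ : Fin N → ℝ} {w : Fin N → Fin N → ℝ} (h : IsRightSingularSystem M ζ w)
    (hζ : Monotone ζ) (U : Submodule ℝ (Fin N → ℝ)) (t : Fin N)
    (ht : (t : ℕ) < Module.finrank ℝ U) (c : ℝ)
    (hc : ∀ u ∈ U, (M *ᵥ u) ⬝ᵥ (M *ᵥ u) ≤ c * (u ⬝ᵥ u)) : ζ t ^ 2 ≤ c := by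
  -- Dually, orthogonality to the first `t` singular vectors is too few conditions to exclude every
  -- nonzero vector of `U`.
  let f : U →ₗ[ℝ] (Finset.Iio t → ℝ) :=
    (Matrix.mulVecLin (Matrix.of fun (i : Finset.Iio t) x => w i x)) ∘ₗ U.subtype
  have hker : LinearMap.ker f ≠ ⊥ := by
    apply LinearMap.ker_ne_bot_of_finrank_lt
    rw [Module.finrank_fintype_fun_eq_card, Fintype.card_coe, Fin.card_Iio]
    exact ht
  obtain ⟨⟨u, hu⟩, ha, ha0⟩ := Submodule.exists_mem_ne_zero_of_ne_bot hker
  have hu0 : u ≠ 0 := fun h0 => ha0 (by simp [h0])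
  have hw : ∀ i < t, w i ⬝ᵥ u = 0 := fun i hi =>
    congrFun (LinearMap.mem_ker.1 ha) ⟨i, Finset.mem_Iio.2 hi⟩
  have h1 := hc u hu
  rw [h.mulVec_dotProduct_self] at h1
  have h2 : ζ t ^ 2 * (u ⬝ᵥ u) ≤ ∑ i, ζ i ^ 2 * (w i ⬝ᵥ u) ^ 2 := by
    rw [dotProduct_eq_sum_of_orthonormal h.orthonormal u, Finset.mul_sum]
    refine Finset.sum_le_sum fun i _ => ?_
    rw [← sq]
    rcases lt_or_ge i t with hi | hi
    · simp [hw i hi]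
    · have := h.nonneg t
      have := hζ hi
      gcongr
  exact le_of_mul_le_mul_right (h2.trans h1) (dotProduct_self_pos hu0)

/-- Every real matrix has a right singular system with increasing singular values. -/
lemma exists_isRightSingularSystem_monotone {m : Type*} [Fintype m] {N : ℕ}
    (M : Matrix m (Fin N) ℝ) :
    ∃ (ζ : Fin N → ℝ) (w : Fin N → Fin N → ℝ), IsRightSingularSystem M ζ w ∧ Monotone ζ := by
  have hps : (Mᵀ * M).PosSemidef := by
    simpa using Matrix.posSemidef_conjTranspose_mul_self M
  have hA := hps.isHermitian
  let s := Tuple.sort hA.eigenvalues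
  refine ⟨fun i => √(hA.eigenvalues (s i)), fun i => ⇑(hA.eigenvectorBasis (s i)),
    ⟨fun i => Real.sqrt_nonneg _, fun i j => ?_, fun i => ?_⟩, fun i j hij => ?_⟩
  · have := orthonormal_iff_ite.1 hA.eigenvectorBasis.orthonormal (s j) (s i)
    rw [EuclideanSpace.inner_eq_star_dotProduct] at this
    simpa [eq_comm] using this
  · rw [hA.mulVec_eigenvectorBasis, Real.sq_sqrt (hps.eigenvalues_nonneg _)]
  · exact Real.sqrt_le_sqrt (Tuple.monotone_sort hA.eigenvalues hij)

/-! ### The Kronecker structure -/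

lemma kronMat_mulVec_prod {d k N : ℕ} (w : Fin d → Fin N → ℝ) (r : RowIndex d k N) :
    (kronMat d k N *ᵥ fun x => ∏ i, w i (x i)) r =
      ∏ i, (diffMat N (blockOrder k r.1 i) *ᵥ w i) (r.2 i) := by
  simp only [Matrix.mulVec, dotProduct, kronMat, Matrix.of_apply, Finset.prod_univ_sum,
    ← Finset.prod_mul_distrib, Fintype.piFinset_univ]

lemma kronMat_gram_mulVec_prod {d k N : ℕ} (w : Fin d → Fin N → ℝ) (x : Lattice d N) :
    (((kronMat d k N)ᵀ * kronMat d k N) *ᵥ fun x => ∏ i, w i (x i)) x =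
      ∑ j : Fin d, ∏ i, (((diffMat N (blockOrder k j i))ᵀ * diffMat N (blockOrder k j i)) *ᵥ w i)
        (x i) := by
  rw [← Matrix.mulVec_mulVec]
  rw [Matrix.mulVec, dotProduct, Fintype.sum_sigma]
  refine Finset.sum_congr rfl fun j _ => ?_
  simp_rw [kronMat_mulVec_prod, ← Matrix.mulVec_mulVec]
  simp only [Matrix.mulVec, dotProduct, kronMat, Matrix.of_apply, Matrix.transpose_apply,
    ← Finset.prod_mul_distrib]
  rw [Finset.prod_univ_sum, Fintype.piFinset_univ]

/-- Tensor products of one-dimensional singular vectors diagonalise the Kronecker sum: in block `j`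
every factor but the `j`-th is the identity, so the block contributes the eigenvalue `ζ (i j) ^ 2`.
-/
lemma IsRightSingularSystem.isEigenmapsSystem {d k N : ℕ} {ζ : Fin N → ℝ}
    {w : Fin N → Fin N → ℝ} (h : IsRightSingularSystem (diffMat N (k + 1)) ζ w)
    (hζ : Monotone ζ) :
    IsEigenmapsSystem d k N (fun i => √(∑ j, ζ (i j) ^ 2)) (fun i x => ∏ j, w (i j) (x j)) := by
  refine ⟨⟨fun i => Real.sqrt_nonneg _, fun i j => ?_, fun i => ?_⟩, ζ, w, h, hζ, fun i => rfl⟩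
  · have : (fun x : Lattice d N => ∏ l, w (i l) (x l)) ⬝ᵥ (fun x => ∏ l, w (j l) (x l)) =
        ∏ l, w (i l) ⬝ᵥ w (j l) := by
      simp only [dotProduct, Finset.prod_univ_sum, ← Finset.prod_mul_distrib,
        Fintype.piFinset_univ]
    rw [this]
    simp only [h.orthonormal]
    split_ifs with hij
    · simp [hij]
    · obtain ⟨l, hl⟩ := Function.ne_iff.1 hij
      exact Finset.prod_eq_zero (Finset.mem_univ l) (if_neg hl)
  · ext x
    rw [kronMat_gram_mulVec_prod, Real.sq_sqrt (by positivity), Pi.smul_apply, smul_eq_mul,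
      Finset.sum_mul]
    refine Finset.sum_congr rfl fun j _ => ?_
    have : ∀ l, (((diffMat N (blockOrder k j l))ᵀ * diffMat N (blockOrder k j l)) *ᵥ w (i l))
        (x l) = (if l = j then ζ (i j) ^ 2 else 1) * w (i l) (x l) := by
      intro l
      rcases eq_or_ne l j with rfl | hl
      · rw [blockOrder, if_pos rfl, h.gram]; simp
      · rw [blockOrder, if_neg hl]; simp [diffMat, hl]
    simp_rw [this, Finset.prod_mul_distrib]
    simp

/-! ### Iterated differences: discrete Poincaré inequality and bump functions -/

/-- Extension by zero of a vector to a sequence. -/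
def zeroExtend {N : ℕ} (u : Fin N → ℝ) : ℕ → ℝ := fun x => if h : x < N then u ⟨x, h⟩ else 0

@[simp] lemma zeroExtend_val {N : ℕ} (u : Fin N → ℝ) (i : Fin N) : zeroExtend u i = u i := by
  simp [zeroExtend]

lemma firstDiff_mulVec {m : ℕ} (U : ℕ → ℝ) (i : Fin (m - 1)) :
    (firstDiff m *ᵥ fun j => U j) i = U (i + 1) - U i := by
  have hi := i.2
  have h : ∀ j : Fin m, firstDiff m i j * U j =
      (if j = ⟨i + 1, by omega⟩ then U (i + 1) else 0) -
        (if j = ⟨i, by omega⟩ then U i else 0) := by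
    intro j
    simp only [firstDiff, Matrix.of_apply, Fin.ext_iff]
    split_ifs with h1 h2 h2
    · omega
    · simp [h1]
    · simp [h2]
    · simp
  simp [Matrix.mulVec, dotProduct, h]

/-- Viewing vectors as restrictions of sequences on `ℕ` replaces matrix rows by `fwdDiff`; row `i <
N - r` reads only entries below `N`. -/
lemma diffMat_mulVec {N : ℕ} (r : ℕ) (U : ℕ → ℝ) :
    (diffMat N r *ᵥ fun j => U j) = fun i : Fin (N - r) => (fwdDiff 1)^[r] U i := by
  induction r with
  | zero => simp [diffMat]
  | succ r ih =>
    ext i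
    rw [diffMat, ← Matrix.mulVec_mulVec, ih, Function.iterate_succ_apply']
    exact firstDiff_mulVec ((fwdDiff 1)^[r] U) i

lemma dotProduct_fin_eq_sum_range {N : ℕ} (U : ℕ → ℝ) :
    (fun i : Fin N => U i) ⬝ᵥ (fun i : Fin N => U i) = ∑ x ∈ Finset.range N, U x ^ 2 := by
  simp only [dotProduct, ← sq]
  exact Fin.sum_univ_eq_sum_range (fun x => U x ^ 2) N

/-- Telescoping from the zero at `s` and Cauchy–Schwarz cost one factor `ℓ`; summing over the block
costs the other. Stopping at `e - 1` keeps every difference inside the block. -/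
lemma sum_Ico_sq_le_of_eq_zero {V : ℕ → ℝ} {s e ℓ : ℕ} (hV : V s = 0) (hℓ : e ≤ s + ℓ) :
    ∑ x ∈ Finset.Ico s e, V x ^ 2 ≤
      (ℓ : ℝ) ^ 2 * ∑ x ∈ Finset.Ico s (e - 1), fwdDiff 1 V x ^ 2 := by
  have key : ∀ x ∈ Finset.Ico s e,
      V x ^ 2 ≤ ℓ * ∑ y ∈ Finset.Ico s (e - 1), fwdDiff 1 V y ^ 2 := by
    intro x hx
    rw [Finset.mem_Ico] at hx
    have h1 : V x = ∑ y ∈ Finset.Ico s x, fwdDiff 1 V y := by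
      simp only [fwdDiff]
      rw [Finset.sum_Ico_sub V hx.1, hV, sub_zero]
    rw [h1]
    refine (sq_sum_le_card_mul_sum_sq).trans ?_
    have h2 : ((Finset.Ico s x).card : ℝ) ≤ ℓ := by
      rw [Nat.card_Ico]; exact_mod_cast (by omega)
    have h3 : ∑ y ∈ Finset.Ico s x, fwdDiff 1 V y ^ 2 ≤
        ∑ y ∈ Finset.Ico s (e - 1), fwdDiff 1 V y ^ 2 :=
      Finset.sum_le_sum_of_subset_of_nonneg (Finset.Ico_subset_Ico_right (by omega))
        fun _ _ _ => sq_nonneg _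
    gcongr
  refine (Finset.sum_le_card_nsmul _ _ _ key).trans ?_
  rw [nsmul_eq_mul, Nat.card_Ico, sq, mul_assoc]
  have h4 : ((e - s : ℕ) : ℝ) ≤ ℓ := by exact_mod_cast (by omega)
  have h5 : 0 ≤ ∑ y ∈ Finset.Ico s (e - 1), fwdDiff 1 V y ^ 2 :=
    Finset.sum_nonneg fun _ _ => sq_nonneg _
  gcongr

/-- Each order of differencing shortens the range by one on the right, so the differences of order
`p` never read past the block. This is what lets neighbouring blocks be added. -/
lemma sum_Ico_sq_le_iterate {p : ℕ} {U : ℕ → ℝ} {s e ℓ : ℕ}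
    (hU : ∀ r < p, (fwdDiff 1)^[r] U s = 0) (hℓ : e ≤ s + ℓ) :
    ∑ x ∈ Finset.Ico s e, U x ^ 2 ≤
      (ℓ : ℝ) ^ (2 * p) * ∑ x ∈ Finset.Ico s (e - p), (fwdDiff 1)^[p] U x ^ 2 := by
  induction p with
  | zero => simp
  | succ p ih =>
    refine (ih fun r hr => hU r (by omega)).trans ?_
    have := sum_Ico_sq_le_of_eq_zero (e := e - p) (hU p (by omega)) (ℓ := ℓ) (by omega)
    rw [Function.iterate_succ_apply', mul_add, pow_add, mul_assoc, mul_one,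
      show e - (p + 1) = e - p - 1 by omega]
    gcongr

/-- A Poincaré inequality for sequences whose differences of order `< p` vanish at the left
ends `e b` of consecutive blocks of length at most `ℓ`. -/
lemma sum_range_sq_le_of_blocks {p q ℓ : ℕ} {U : ℕ → ℝ} {e : ℕ → ℕ} (he : Monotone e)
    (he0 : e 0 = 0) (heℓ : ∀ b, e (b + 1) ≤ e b + ℓ)
    (hU : ∀ b < q, ∀ r < p, (fwdDiff 1)^[r] U (e b) = 0) :
    ∑ x ∈ Finset.range (e q), U x ^ 2 ≤
      (ℓ : ℝ) ^ (2 * p) * ∑ x ∈ Finset.range (e q - p), (fwdDiff 1)^[p] U x ^ 2 := by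
  induction q with
  | zero => simp [he0]
  | succ q ih =>
    have hm : e q ≤ e (q + 1) := he (by omega)
    have h1 := ih fun b hb => hU b (by omega)
    have h2 := sum_Ico_sq_le_iterate (hU q (by omega)) (heℓ q)
    rw [← Finset.sum_range_add_sum_Ico _ hm]
    refine (add_le_add h1 h2).trans ?_
    rw [← mul_add]
    refine mul_le_mul_of_nonneg_left ?_ (by positivity)
    -- The two ranges are disjoint; the differences straddling the block boundary are only in the
    -- larger sum, where they are nonnegative.
    rw [← Finset.sum_union]
    · refine Finset.sum_le_sum_of_subset_of_nonneg ?_ fun _ _ _ => sq_nonneg _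
      intro x hx
      simp only [Finset.mem_union, Finset.mem_range, Finset.mem_Ico] at hx ⊢
      omega
    · rw [Finset.disjoint_left]
      intro x hx
      simp only [Finset.mem_range, Finset.mem_Ico] at hx ⊢
      omega

/-- Peel off the innermost difference: it commutes with differentiation, and the mean value
inequality bounds the difference of the `p`-th derivative by the next derivative. The induction
needs all `F` at once. -/
lemma abs_fwdDiff_iterate_le {C : ℝ} (p : ℕ) : ∀ F : ℝ → ℝ, ContDiff ℝ p F →
    (∀ x, |iteratedDeriv p F x| ≤ C) → ∀ x, |(fwdDiff 1)^[p] F x| ≤ C := by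
  induction p with
  | zero => intro F _ h x; simpa using h x
  | succ p ih =>
    intro F hF h
    rw [Function.iterate_succ]
    have hF' : ContDiff ℝ p F := hF.of_le (by exact_mod_cast Nat.le_succ p)
    have hs : ContDiff ℝ p (fun x => F (x + 1)) := by fun_prop
    refine ih _ (hs.sub hF') fun x => ?_
    have hd : Differentiable ℝ (iteratedDeriv p F) :=
      hF.differentiable_iteratedDeriv p (by exact_mod_cast Nat.lt_succ_self p)
    have h1 : iteratedDeriv p (fwdDiff 1 F) x =
        iteratedDeriv p F (x + 1) - iteratedDeriv p F x := by
      have : fwdDiff 1 F = (fun x => F (x + 1)) - F := rfl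
      rw [this, iteratedDeriv_sub hs.contDiffAt hF'.contDiffAt, iteratedDeriv_comp_add_const]
    rw [h1]
    have := Convex.norm_image_sub_le_of_norm_deriv_le (f := iteratedDeriv p F) (C := C)
      (s := Set.univ) (fun x _ => hd x)
      (fun x _ => by rw [← iteratedDeriv_succ]; exact h x) convex_univ (Set.mem_univ x)
      (Set.mem_univ (x + 1))
    simpa using this

lemma fwdDiff_iterate_natCast (F : ℝ → ℝ) (p x : ℕ) :
    (fwdDiff 1)^[p] (fun y : ℕ => F y) x = (fwdDiff 1)^[p] F x := by
  simp [fwdDiff_iter_eq_sum_shift]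

lemma fwdDiff_iterate_eq_zero {F : ℕ → ℝ} {p x : ℕ} (h : ∀ i ≤ p, F (x + i) = 0) :
    (fwdDiff 1)^[p] F x = 0 := by
  rw [fwdDiff_iter_eq_sum_shift]
  refine Finset.sum_eq_zero fun i hi => ?_
  simp [h i (by simpa [Nat.lt_succ_iff] using hi)]

/-- A smooth function that equals `1` on `[3/8, 5/8]`, vanishes off `(1/4, 3/4)`, and has a
bounded `p`-th derivative. -/
lemma exists_smooth_bump (p : ℕ) : ∃ (f : ℝ → ℝ) (C : ℝ), 0 < C ∧ ContDiff ℝ p f ∧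
    (∀ x, |iteratedDeriv p f x| ≤ C) ∧ (∀ x, 3 / 8 ≤ x → x ≤ 5 / 8 → f x = 1) ∧
    (∀ x, x ≤ 1 / 4 ∨ 3 / 4 ≤ x → f x = 0) := by
  let f : ContDiffBump (1 / 2 : ℝ) := ⟨1 / 8, 1 / 4, by norm_num, by norm_num⟩
  have hf : ContDiff ℝ p f := f.contDiff
  obtain ⟨C, hC⟩ := (hf.continuous_iteratedDeriv p le_rfl).bounded_above_of_compact_support
    (by
      rw [iteratedDeriv_eq_iterate]
      clear hf
      induction p with
      | zero => exact f.hasCompactSupport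
      | succ p ih => rw [Function.iterate_succ_apply']; exact ih.deriv)
  refine ⟨f, max C 1, by positivity, hf, fun x => (hC x).trans (le_max_left _ _), ?_, ?_⟩
  · intro x h1 h2
    apply f.one_of_mem_closedBall
    rw [Metric.mem_closedBall, Real.dist_eq, abs_le]
    constructor <;> simp only [f] <;> linarith
  · intro x hx
    apply f.zero_of_le_dist
    rw [Real.dist_eq, le_abs]
    simp only [f]
    rcases hx with hx | hx
    · right; linarith
    · left; linarith

/-! ### Singular values of the difference matrix -/

lemma zeroExtend_add {N : ℕ} (u u' : Fin N → ℝ) :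
    zeroExtend (u + u') = zeroExtend u + zeroExtend u' := by
  ext x; simp only [zeroExtend, Pi.add_apply]; split_ifs <;> simp

lemma zeroExtend_smul {N : ℕ} (c : ℝ) (u : Fin N → ℝ) :
    zeroExtend (c • u) = c • zeroExtend u := by
  ext x; simp only [zeroExtend, Pi.smul_apply]; split_ifs <;> simp

/-- Cut the axis into `q = t / p` blocks and ask that all differences of order `< p` vanish at their
left ends. These are `q * p ≤ t` linear conditions, under which the blockwise Poincaré inequality
holds with constant `ℓ ^ (2 * p)`, `ℓ ≈ N / q`. The factor `4` collects two roundings, `ℓ * q ≤ 2 *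
N` and `t ≤ 2 * q * p`. -/
lemma singularValue_diffMat_lower {N p : ℕ} (hp : 0 < p) {ζ : Fin N → ℝ} {w : Fin N → Fin N → ℝ}
    (h : IsRightSingularSystem (diffMat N p) ζ w) (hζ : Monotone ζ) (t : Fin N)
    (ht : p ≤ t) : ((t : ℝ) / (4 * p * N)) ^ (2 * p) ≤ ζ t ^ 2 := by
  set q : ℕ := t / p with hq
  have hq1 : 1 ≤ q := (Nat.one_le_div_iff hp).2 ht
  have hqp : q * p ≤ t := Nat.div_mul_le_self _ _
  have hqt : (t : ℕ) < (q + 1) * p := by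
    rw [mul_comm]; exact Nat.lt_mul_div_succ _ hp
  set ℓ : ℕ := N / q + 1 with hℓ
  have hN : N ≤ q * ℓ := (Nat.lt_mul_div_succ N hq1).le
  have hqN : q ≤ N := (Nat.div_le_self _ _).trans t.2.le
  -- Left ends are clipped at `N`. Near the right end the conditions may involve zeros of the
  -- extension; this is harmless, as only their linearity and their number matter.
  let e : ℕ → ℕ := fun b => min (b * ℓ) N
  let f : (Fin N → ℝ) →ₗ[ℝ] (Fin q × Fin p → ℝ) :=
    { toFun := fun u br => (fwdDiff 1)^[br.2] (zeroExtend u) (e br.1)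
      map_add' := fun u u' => by
        ext br; simp [zeroExtend_add]
      map_smul' := fun c u => by
        ext br; simp [zeroExtend_smul] }
  have hℓ0 : (0 : ℝ) < ℓ := by rw [hℓ]; positivity
  have key : ((ℓ : ℝ) ^ (2 * p))⁻¹ ≤ ζ t ^ 2 := by
    refine le_singularValue_sq h hζ f t (by simpa using hqp) _ fun u hu => ?_
    have h1 := sum_range_sq_le_of_blocks (p := p) (q := q) (ℓ := ℓ) (U := zeroExtend u) (e := e)
      (fun a b hab => min_le_min_right _ (Nat.mul_le_mul_right _ hab)) (by simp [e])
      (fun b => by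
        have hmin : ∀ z l n : ℕ, min (z + l) n ≤ min z n + l := fun z l n => by omega
        simpa only [e, add_mul, one_mul] using hmin _ _ _)
      (fun b hb r hr => congrFun hu (⟨b, hb⟩, ⟨r, hr⟩))
    have he : e q = N := min_eq_right hN
    rw [he, ← dotProduct_fin_eq_sum_range, ← dotProduct_fin_eq_sum_range,
      ← diffMat_mulVec] at h1
    simp only [zeroExtend_val] at h1
    rw [inv_mul_le_iff₀ (by positivity)]
    exact h1
  refine le_trans ?_ key
  rw [← inv_pow]
  have hN0 : (0 : ℝ) < N := by exact_mod_cast hq1.trans hqN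
  have hp0 : (0 : ℝ) < p := by exact_mod_cast hp
  have hq0 : (0 : ℝ) < q := by exact_mod_cast hq1
  refine pow_le_pow_left₀ (by positivity) ?_ _
  rw [div_le_iff₀ (by positivity), ← div_eq_inv_mul, le_div_iff₀ hℓ0]
  have h1 : (ℓ : ℝ) * q ≤ 2 * N := by
    have : ℓ * q ≤ 2 * N := by
      rw [hℓ, add_mul, one_mul]
      have := Nat.div_mul_le_self N q
      omega
    exact_mod_cast this
  have h2 : (t : ℝ) ≤ 2 * q * p := by
    have : (t : ℕ) ≤ 2 * q * p := hqt.le.trans (Nat.mul_le_mul_right _ (by omega))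
    exact_mod_cast this
  calc (t : ℝ) * ℓ ≤ 2 * q * p * ℓ := by gcongr
    _ = 2 * p * (ℓ * q) := by ring
    _ ≤ 2 * p * (2 * N) := by gcongr
    _ = 4 * p * N := by ring

/-! ### Upper bounds for singular values from disjoint bumps. -/

lemma sq_sum_of_disjoint {β : Type*} [Fintype β] (c : β → ℝ)
    (hc : ∀ b b', b ≠ b' → c b = 0 ∨ c b' = 0) : (∑ b, c b) ^ 2 = ∑ b, c b ^ 2 := by
  rw [sq, Finset.sum_mul_sum]
  refine Finset.sum_congr rfl fun b _ => ?_
  rw [Finset.sum_eq_single b _ (by simp), sq]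
  intro b' _ hb
  rcases hc b b' hb.symm with h | h <;> simp [h]

lemma sum_sq_of_disjoint_support {M : ℕ} (s : Finset ℕ) (G : Fin M → ℕ → ℝ) {L : ℕ}
    (hG : ∀ b x, G b x ≠ 0 → x / L = b) (a : Fin M → ℝ) :
    ∑ x ∈ s, (∑ b, a b * G b x) ^ 2 = ∑ b, a b ^ 2 * ∑ x ∈ s, G b x ^ 2 := by
  simp_rw [Finset.mul_sum]
  rw [Finset.sum_comm]
  refine Finset.sum_congr rfl fun x _ => ?_
  rw [sq_sum_of_disjoint]
  · simp_rw [mul_pow]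
  · intro b b' hb
    by_contra! hcon
    exact hb (Fin.ext ((hG b x (right_ne_zero_of_mul hcon.1)).symm.trans
      (hG b' x (right_ne_zero_of_mul hcon.2))))

/-- Place `t + 1` rescaled bumps in disjoint blocks of length `L = 8 * h`. Each equals `1` at `h`
points at least, hence has squared norm at least `h`; its `p`-th difference is at most `C * L⁻ᵖ` and
lives on one block, hence has squared norm at most `L * (C * L⁻ᵖ) ^ 2`. Disjointness carries the
ratio `8 * C ^ 2 * L ^ (-2p)` over to their whole span, of dimension `t + 1`. -/
lemma exists_singularValue_diffMat_le_of_bumps (p : ℕ) : ∃ C : ℝ, 0 < C ∧ ∀ (N h : ℕ)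
    (ζ : Fin N → ℝ) (w : Fin N → Fin N → ℝ), IsRightSingularSystem (diffMat N p) ζ w →
    Monotone ζ → ∀ t : Fin N, 0 < h → p ≤ 2 * h → (t + 1) * (8 * h) ≤ N →
    ζ t ^ 2 ≤ C * (1 / (8 * h : ℝ)) ^ (2 * p) := by
  obtain ⟨f, C, hC, hf, hfC, hf1, hf0⟩ := exists_smooth_bump p
  refine ⟨8 * C ^ 2, by positivity, fun N h ζ w hsys hζ t hh hph hN => ?_⟩
  set L : ℕ := 8 * h with hL
  have hL0 : (0 : ℝ) < L := by exact_mod_cast (by omega)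
  have hLh : (L : ℝ) = 8 * h := by rw [hL]; push_cast; rfl
  let F : Fin (t + 1) → ℕ → ℝ := fun b x => f ((1 / L : ℝ) * (x : ℝ) - (b : ℕ))
  have hF0 : ∀ (b : Fin (t + 1)) (x : ℕ), 4 * x ≤ (4 * b + 1) * L ∨ (4 * b + 3) * L ≤ 4 * x →
      F b x = 0 := by
    intro b x hx
    refine hf0 _ (hx.imp (fun hx => ?_) fun hx => ?_)
    · have : 4 * (x : ℝ) ≤ (4 * (b : ℕ) + 1) * L := by exact_mod_cast hx
      rw [sub_le_iff_le_add, one_div_mul_eq_div, div_le_iff₀ hL0]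
      linarith
    · have : (4 * ((b : ℕ) : ℝ) + 3) * L ≤ 4 * (x : ℝ) := by exact_mod_cast hx
      rw [le_sub_iff_add_le, one_div_mul_eq_div, le_div_iff₀ hL0]
      linarith
  have hLp : 0 < L := by omega
  have hFs : ∀ b x, F b x ≠ 0 → x / L = b := by
    intro b x hx
    contrapose! hx
    refine hF0 b x ?_
    rcases lt_or_gt_of_ne hx with h1 | h1
    · left
      have := (Nat.div_lt_iff_lt_mul hLp).1 h1
      nlinarith
    · right
      have := (Nat.le_div_iff_mul_le hLp).1 (Nat.succ_le_of_lt h1)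
      rw [Nat.succ_eq_add_one] at this
      nlinarith
  -- A `p`-th difference reads `p` points to the right, and `p ≤ 2 * h = L / 4` is the margin left
  -- of the bump, so the support stays in the block.
  have hDs : ∀ b x, (fwdDiff 1)^[p] (F b) x ≠ 0 → x / L = b := by
    intro b x hx
    contrapose! hx
    refine fwdDiff_iterate_eq_zero fun i hi => hF0 b _ ?_
    rcases lt_or_gt_of_ne hx with h1 | h1
    · left
      have := (Nat.div_lt_iff_lt_mul hLp).1 h1
      nlinarith
    · right
      have := (Nat.le_div_iff_mul_le hLp).1 (Nat.succ_le_of_lt h1)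
      rw [Nat.succ_eq_add_one] at this
      nlinarith
  have hDb : ∀ b x, |(fwdDiff 1)^[p] (F b) x| ≤ C * (1 / L : ℝ) ^ p := by
    intro b x
    rw [fwdDiff_iterate_natCast (fun y : ℝ => f ((1 / L : ℝ) * y - (b : ℕ)))]
    have hf' : ContDiff ℝ p fun y => f (y - (b : ℕ)) := hf.comp (contDiff_id.sub contDiff_const)
    refine abs_fwdDiff_iterate_le p _ (hf'.comp (contDiff_const.mul contDiff_id)) (fun y => ?_) _
    have := congrFun (iteratedDeriv_comp_const_mul hf' (1 / L : ℝ)) y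
    simp only [iteratedDeriv_comp_sub_const] at this
    have h3 : (fun y : ℝ => f ((1 / L : ℝ) * y - (b : ℕ))) =
      ((fun y => f (y - ((b : ℕ) : ℝ))) ∘ fun y => (1 / L : ℝ) * y) := rfl
    change |iteratedDeriv p (fun y : ℝ => f ((1 / L : ℝ) * y - (b : ℕ))) y| ≤ _
    rw [this, abs_mul, abs_of_nonneg (by positivity), mul_comm]
    exact mul_le_mul_of_nonneg_right (hfC _) (by positivity)
  have hlow : ∀ b, (h : ℝ) ≤ ∑ x ∈ Finset.range N, F b x ^ 2 := by
    intro b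
    have hb : ((b : ℕ) + 1) * L ≤ (t + 1) * L := Nat.mul_le_mul_right _ (by omega)
    have hsub : Finset.Ico (b * L + 4 * h) (b * L + 5 * h) ⊆ Finset.range N := by
      intro x hx
      simp only [Finset.mem_Ico, Finset.mem_range] at hx ⊢
      rw [add_mul, one_mul] at hb
      omega
    refine le_trans ?_ (Finset.sum_le_sum_of_subset_of_nonneg hsub fun _ _ _ => sq_nonneg _)
    have h1 : ∀ x ∈ Finset.Ico (b * L + 4 * h) (b * L + 5 * h), F b x ^ 2 = 1 := by
      intro x hx
      rw [Finset.mem_Ico] at hx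
      have h2 : ((b : ℕ) * L + 4 * h : ℝ) ≤ x := by exact_mod_cast hx.1
      have h3 : (x : ℝ) ≤ (b : ℕ) * L + 5 * h := by exact_mod_cast hx.2.le
      have : F b x = 1 := by
        refine hf1 _ ?_ ?_
        · rw [le_sub_iff_add_le, one_div_mul_eq_div, le_div_iff₀ hL0]
          linarith
        · rw [sub_le_iff_le_add, one_div_mul_eq_div, div_le_iff₀ hL0]
          linarith
      rw [this, one_pow]
    rw [Finset.sum_congr rfl h1, Finset.sum_const, Nat.card_Ico, nsmul_eq_mul, mul_one]
    exact_mod_cast (by omega)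
  have hup : ∀ b, ∑ x ∈ Finset.range (N - p), (fwdDiff 1)^[p] (F b) x ^ 2 ≤
      L * (C * (1 / L : ℝ) ^ p) ^ 2 := by
    intro b
    have hsub : (Finset.range (N - p)).filter (fun x => (fwdDiff 1)^[p] (F b) x ^ 2 ≠ 0) ⊆
        Finset.Ico (b * L) (b * L + L) := by
      intro x hx
      rw [Finset.mem_filter] at hx
      have := hDs b x (fun h0 => hx.2 (by rw [h0]; simp))
      have h2 := Nat.div_add_mod x L
      have h3 := Nat.mod_lt x hLp
      rw [this, mul_comm] at h2
      rw [Finset.mem_Ico]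
      omega
    rw [← Finset.sum_filter_ne_zero]
    refine (Finset.sum_le_card_nsmul _ _ ((C * (1 / L : ℝ) ^ p) ^ 2) fun x _ => ?_).trans ?_
    · rw [← sq_abs]
      exact pow_le_pow_left₀ (abs_nonneg _) (hDb b x) 2
    · rw [nsmul_eq_mul]
      have : (((Finset.range (N - p)).filter
          (fun x => (fwdDiff 1)^[p] (F b) x ^ 2 ≠ 0)).card : ℝ) ≤ L := by
        have := Finset.card_le_card hsub
        rw [Nat.card_Ico, Nat.add_sub_cancel_left] at this
        exact_mod_cast this
      gcongr
  let g : (Fin (t + 1) → ℝ) →ₗ[ℝ] (Fin N → ℝ) :=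
    Matrix.mulVecLin (Matrix.of fun (x : Fin N) b => F b x)
  have hg : ∀ a, g a = fun x : Fin N => ∑ b, a b * F b x := by
    intro a; ext x; simp [g, Matrix.mulVec, dotProduct, mul_comm]
  have hgg : ∀ a, h * ∑ b, a b ^ 2 ≤ g a ⬝ᵥ g a := by
    intro a
    rw [hg, dotProduct_fin_eq_sum_range (fun x : ℕ => ∑ b, a b * F b x),
      sum_sq_of_disjoint_support _ _ hFs, Finset.mul_sum]
    refine Finset.sum_le_sum fun b _ => ?_
    rw [mul_comm]
    exact mul_le_mul_of_nonneg_left (hlow b) (sq_nonneg _)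
  have hh0 : (0 : ℝ) < h := by exact_mod_cast hh
  have hinj : Function.Injective g := by
    rw [injective_iff_map_eq_zero]
    intro a ha
    have h1 := hgg a
    rw [ha, dotProduct_zero] at h1
    have h2 : ∑ b, a b ^ 2 = 0 := le_antisymm
      (nonpos_of_mul_nonpos_right h1 hh0) (Finset.sum_nonneg fun _ _ => sq_nonneg _)
    rw [Finset.sum_eq_zero_iff_of_nonneg fun _ _ => sq_nonneg _] at h2
    ext b
    simpa using h2 b (Finset.mem_univ b)
  refine singularValue_sq_le hsys hζ (LinearMap.range g) t ?_ _ ?_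
  · rw [LinearMap.finrank_range_of_inj hinj]; simp
  rintro _ ⟨a, rfl⟩
  have h1 : (diffMat N p *ᵥ g a) ⬝ᵥ (diffMat N p *ᵥ g a) =
      ∑ b, a b ^ 2 * ∑ x ∈ Finset.range (N - p), (fwdDiff 1)^[p] (F b) x ^ 2 := by
    rw [hg, diffMat_mulVec p (fun x : ℕ => ∑ b, a b * F b x), dotProduct_fin_eq_sum_range,
      ← sum_sq_of_disjoint_support _ _ hDs]
    have : (fun x : ℕ => ∑ b, a b * F b x) = ∑ b, a b • F b := by ext x; simp
    simp [this]
  rw [h1]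
  calc ∑ b, a b ^ 2 * ∑ x ∈ Finset.range (N - p), (fwdDiff 1)^[p] (F b) x ^ 2
      ≤ ∑ b, a b ^ 2 * (L * (C * (1 / L : ℝ) ^ p) ^ 2) := by
        gcongr with b _; exact hup b
    _ = 8 * C ^ 2 * (1 / (8 * h : ℝ)) ^ (2 * p) * (h * ∑ b, a b ^ 2) := by
        rw [← Finset.sum_mul, hLh]; ring
    _ ≤ _ := by gcongr; exact hgg a

/-- Use the widest bumps for which `t + 1` blocks fit. The condition on `t` keeps `h` above `p`, and
rounding loses at most a factor `2` in the block length. -/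
lemma exists_singularValue_diffMat_le (p : ℕ) : ∃ C : ℝ, 0 < C ∧ ∀ (N : ℕ)
    (ζ : Fin N → ℝ) (w : Fin N → Fin N → ℝ), IsRightSingularSystem (diffMat N p) ζ w →
    Monotone ζ → ∀ t : Fin N, 8 * (p + 1) * (t + 1) ≤ N →
    ζ t ^ 2 ≤ C * (((t : ℝ) + 1) / N) ^ (2 * p) := by
  obtain ⟨C, hC, hb⟩ := exists_singularValue_diffMat_le_of_bumps p
  refine ⟨C * 2 ^ (2 * p), by positivity, fun N ζ w hsys hζ t ht => ?_⟩
  set h : ℕ := N / (8 * (t + 1)) with hh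
  have h1 : p + 1 ≤ h := (Nat.le_div_iff_mul_le (by positivity)).2 (by nlinarith)
  have h2 : h * (8 * (t + 1)) ≤ N := Nat.div_mul_le_self _ _
  have h3 : N < (8 * (t + 1)) * (h + 1) := Nat.lt_mul_div_succ _ (by positivity)
  refine (hb N h ζ w hsys hζ t (by omega) (by omega) (by nlinarith)).trans ?_
  have hN0 : (0 : ℝ) < N := by exact_mod_cast t.pos
  have hh0 : (0 : ℝ) < h := by exact_mod_cast (by omega : 0 < h)
  rw [mul_assoc, ← mul_pow]
  refine mul_le_mul_of_nonneg_left (pow_le_pow_left₀ (by positivity) ?_ _) hC.le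
  rw [mul_div_assoc', div_le_div_iff₀ (by positivity) hN0]
  have h4 : N ≤ 2 * (t + 1) * (8 * h) := by nlinarith
  have h5 : (N : ℝ) ≤ 2 * (t + 1) * (8 * h) := by exact_mod_cast h4
  linarith

/-- The smallest singular value vanishes for differences of positive order. -/
lemma singularValue_diffMat_zero {N p : ℕ} (hp : 0 < p) {ζ : Fin N → ℝ} {w : Fin N → Fin N → ℝ}
    (h : IsRightSingularSystem (diffMat N p) ζ w) (hζ : Monotone ζ) (t : Fin N)
    (ht : (t : ℕ) = 0) : ζ t = 0 := by
  have hker : LinearMap.ker (diffMat N p).mulVecLin ≠ ⊥ := by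
    apply LinearMap.ker_ne_bot_of_finrank_lt
    simp only [Module.finrank_fintype_fun_eq_card, Fintype.card_fin]
    have := t.pos
    omega
  have h1 := singularValue_sq_le h hζ (LinearMap.ker (diffMat N p).mulVecLin) t
    (by rw [ht]; exact Nat.pos_of_ne_zero fun h0 => hker (Submodule.finrank_eq_zero.1 h0)) 0
    (fun u hu => by
      have : diffMat N p *ᵥ u = 0 := hu
      simp [this])
  exact pow_eq_zero_iff two_ne_zero |>.1 (le_antisymm h1 (sq_nonneg _))

/-! ### Gaussian product measures -/

section Gaussian

variable {ι : Type*} [Fintype ι]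

instance (σ : ℝ≥0) (θ : ι → ℝ) : IsProbabilityMeasure (dataLaw σ θ) := by
  unfold dataLaw; infer_instance

lemma lintegral_pi_prod {μ : ι → Measure ℝ} [∀ x, IsProbabilityMeasure (μ x)]
    {g : ι → ℝ → ℝ≥0∞} (hg : ∀ x, Measurable (g x)) :
    ∫⁻ y, ∏ x, g x (y x) ∂(Measure.pi μ) = ∏ x, ∫⁻ z, g x z ∂(μ x) := by
  rw [lintegral_prod_eq_prod_lintegral_of_indepFun Finset.univ (fun x (y : ι → ℝ) => g x (y x))
    (iIndepFun_pi fun x => (hg x).aemeasurable) fun x => (hg x).comp (measurable_pi_apply x)]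
  exact Finset.prod_congr rfl fun x _ => (measurePreserving_eval μ x).lintegral_comp (hg x)

/-- It suffices to test boxes, where the indicator factors over the coordinates. -/
lemma pi_withDensity {μ : ι → Measure ℝ} [∀ x, IsProbabilityMeasure (μ x)]
    {g : ι → ℝ → ℝ≥0∞} (hg : ∀ x, Measurable (g x))
    [∀ x, IsProbabilityMeasure ((μ x).withDensity (g x))] :
    Measure.pi (fun x => (μ x).withDensity (g x)) =
      (Measure.pi μ).withDensity fun y => ∏ x, g x (y x) := by
  refine Measure.pi_eq fun s hs => ?_
  rw [withDensity_apply _ (MeasurableSet.univ_pi hs),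
    ← lintegral_indicator (MeasurableSet.univ_pi hs)]
  have : ((Set.univ.pi s).indicator fun y : ι → ℝ => ∏ x, g x (y x)) =
      fun y => ∏ x, (s x).indicator (g x) (y x) := by
    ext y
    by_cases hy : y ∈ Set.univ.pi s
    · rw [Set.indicator_of_mem hy]
      exact Finset.prod_congr rfl fun x _ => (Set.indicator_of_mem (hy x trivial) _).symm
    · rw [Set.indicator_of_notMem hy]
      simp only [Set.mem_univ_pi, not_forall] at hy
      obtain ⟨x, hx⟩ := hy
      exact (Finset.prod_eq_zero (Finset.mem_univ x) (Set.indicator_of_notMem hx _)).symm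
  rw [this, lintegral_pi_prod fun x => (hg x).indicator (hs x)]
  refine Finset.prod_congr rfl fun x _ => ?_
  rw [lintegral_indicator (hs x), withDensity_apply _ (hs x)]

/-- The log-likelihood ratio of `N(a, v)` with respect to `N(m, v)`. -/
def logRatio (v a m y : ℝ) : ℝ := ((a - m) * (y - m) - (a - m) ^ 2 / 2) / v

lemma measurable_logRatio (v a m : ℝ) : Measurable (logRatio v a m) := by
  unfold logRatio; fun_prop

lemma gaussianReal_eq_withDensity {v : ℝ≥0} (hv : v ≠ 0) (a m : ℝ) :
    gaussianReal a v =
      (gaussianReal m v).withDensity fun y => ENNReal.ofReal (Real.exp (logRatio v a m y)) := by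
  rw [gaussianReal_of_var_ne_zero _ hv, gaussianReal_of_var_ne_zero _ hv,
    ← withDensity_mul _ (measurable_gaussianPDF m v)
      (measurable_logRatio v a m).exp.ennreal_ofReal]
  congr 1
  ext y
  have hv' : (v : ℝ) ≠ 0 := by exact_mod_cast hv
  rw [Pi.mul_apply, gaussianPDF, gaussianPDF,
    ← ENNReal.ofReal_mul (gaussianPDFReal_nonneg _ _ _), gaussianPDFReal, gaussianPDFReal,
    mul_assoc _ (Real.exp _) (Real.exp _), ← Real.exp_add]
  congr 3
  rw [logRatio]
  field_simp
  ring

lemma dataLaw_eq_withDensity {σ : ℝ≥0} (hσ : 0 < σ) (θ m : ι → ℝ) :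
    dataLaw σ θ = (dataLaw σ m).withDensity fun y =>
      ENNReal.ofReal (Real.exp (∑ x, logRatio (σ ^ 2) (θ x) (m x) (y x))) := by
  have hv : σ ^ 2 ≠ 0 := by positivity
  have hd := fun x => gaussianReal_eq_withDensity hv (θ x) (m x)
  have : ∀ x, IsProbabilityMeasure ((gaussianReal (m x) (σ ^ 2)).withDensity
      fun y => ENNReal.ofReal (Real.exp (logRatio (σ ^ 2 : ℝ≥0) (θ x) (m x) y))) := by
    intro x; rw [← hd]; infer_instance
  rw [dataLaw]
  simp_rw [hd]
  rw [pi_withDensity fun x => (measurable_logRatio _ _ _).exp.ennreal_ofReal, dataLaw]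
  simp_rw [Real.exp_sum, ENNReal.ofReal_prod_of_nonneg fun _ _ => (Real.exp_pos _).le]
  simp

/-! ### Lower bound: two points and the hypercube -/

/-- `A` and `B` play the role of log-likelihood ratios. From `A + B ≥ -1`, `e^(A/2) e^(B/2) ≥ 1/2`;
then use `|a - b| ≤ |t - a| + |t - b|` and AM–GM, balanced so that after integration the remainder
is half of the left side. -/
lemma two_point_pointwise {a b t A B : ℝ} (hAB : -1 ≤ A + B) :
    (a - b) ^ 2 / 4 ≤ (t - a) ^ 2 * Real.exp A + (t - b) ^ 2 * Real.exp B +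
      (a - b) ^ 2 / 16 * (Real.exp A + Real.exp B) := by
  set s := Real.exp (A / 2)
  set r := Real.exp (B / 2)
  have hs : Real.exp A = s ^ 2 := by rw [← Real.exp_nat_mul]; congr 1; push_cast; ring
  have hr : Real.exp B = r ^ 2 := by rw [← Real.exp_nat_mul]; congr 1; push_cast; ring
  have hsr : 1 / 2 ≤ s * r := by
    rw [← Real.exp_add]
    have := Real.add_one_le_exp (A / 2 + B / 2)
    linarith
  rw [hs, hr]
  have h1 : |t - a| * |a - b| * (s * r) / 2 ≤ (t - a) ^ 2 * s ^ 2 + (a - b) ^ 2 / 16 * r ^ 2 := by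
    nlinarith [sq_nonneg (|t - a| * s - |a - b| * r / 4), sq_abs (t - a), sq_abs (a - b)]
  have h2 : |t - b| * |a - b| * (s * r) / 2 ≤ (t - b) ^ 2 * r ^ 2 + (a - b) ^ 2 / 16 * s ^ 2 := by
    nlinarith [sq_nonneg (|t - b| * r - |a - b| * s / 4), sq_abs (t - b), sq_abs (a - b)]
  have h3 : |a - b| ≤ |t - a| + |t - b| := by
    have := abs_sub_le a t b
    rwa [abs_sub_comm a t] at this
  have h4 : (a - b) ^ 2 ≤ (|t - a| + |t - b|) * |a - b| := by
    rw [← sq_abs, sq]; gcongr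
  have h5 : (|t - a| + |t - b|) * |a - b| * (1 / 2) ≤ (|t - a| + |t - b|) * |a - b| * (s * r) := by
    gcongr
  linarith

/-- Relative to the midpoint the terms linear in `y` cancel, so the product of the two likelihood
ratios is deterministic. -/
lemma sum_logRatio_midpoint (v : ℝ) (θ θ' y : ι → ℝ) :
    ∑ x, logRatio v (θ x) ((θ x + θ' x) / 2) (y x) +
      ∑ x, logRatio v (θ' x) ((θ x + θ' x) / 2) (y x) =
      -((θ - θ') ⬝ᵥ (θ - θ')) / (4 * v) := by
  rw [← Finset.sum_add_distrib, dotProduct, ← Finset.sum_neg_distrib, Finset.sum_div]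
  refine Finset.sum_congr rfl fun x _ => ?_
  simp only [logRatio, Pi.sub_apply]
  rw [← add_div, ← div_div]
  congr 1
  ring

/-- Le Cam's two-point bound for estimating a real parameter in squared error. -/
lemma two_point_lower_bound {σ : ℝ≥0} (hσ : 0 < σ) {θ θ' : ι → ℝ}
    (hθ : (θ - θ') ⬝ᵥ (θ - θ') ≤ 4 * (σ : ℝ) ^ 2) {t : (ι → ℝ) → ℝ} (ht : Measurable t) (a b : ℝ) :
    ENNReal.ofReal ((a - b) ^ 2 / 8) ≤
      ∫⁻ y, ENNReal.ofReal ((t y - a) ^ 2) ∂(dataLaw σ θ) +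
        ∫⁻ y, ENNReal.ofReal ((t y - b) ^ 2) ∂(dataLaw σ θ') := by
  let m : ι → ℝ := fun x => (θ x + θ' x) / 2
  have hσ' : (0 : ℝ) < σ := hσ
  let A : (ι → ℝ) → ℝ := fun y => ∑ x, logRatio (σ ^ 2) (θ x) (m x) (y x)
  let B : (ι → ℝ) → ℝ := fun y => ∑ x, logRatio (σ ^ 2) (θ' x) (m x) (y x)
  have hA : Measurable fun y => ENNReal.ofReal (Real.exp (A y)) :=
    (Finset.measurable_sum _ fun x _ =>
      (measurable_logRatio _ _ _).comp (measurable_pi_apply x)).exp.ennreal_ofReal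
  have hB : Measurable fun y => ENNReal.ofReal (Real.exp (B y)) :=
    (Finset.measurable_sum _ fun x _ =>
      (measurable_logRatio _ _ _).comp (measurable_pi_apply x)).exp.ennreal_ofReal
  have hdA : dataLaw σ θ = (dataLaw σ m).withDensity fun y => ENNReal.ofReal (Real.exp (A y)) :=
    dataLaw_eq_withDensity hσ θ m
  have hdB : dataLaw σ θ' = (dataLaw σ m).withDensity fun y => ENNReal.ofReal (Real.exp (B y)) :=
    dataLaw_eq_withDensity hσ θ' m
  have hA1 : ∫⁻ y, ENNReal.ofReal (Real.exp (A y)) ∂(dataLaw σ m) = 1 := by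
    have : dataLaw σ θ Set.univ = 1 := measure_univ
    rwa [hdA, withDensity_apply _ MeasurableSet.univ, Measure.restrict_univ] at this
  have hB1 : ∫⁻ y, ENNReal.ofReal (Real.exp (B y)) ∂(dataLaw σ m) = 1 := by
    have : dataLaw σ θ' Set.univ = 1 := measure_univ
    rwa [hdB, withDensity_apply _ MeasurableSet.univ, Measure.restrict_univ] at this
  have hta : Measurable fun y => ENNReal.ofReal ((t y - a) ^ 2) := by fun_prop
  have htb : Measurable fun y => ENNReal.ofReal ((t y - b) ^ 2) := by fun_prop
  have hAB : ∀ y, -1 ≤ A y + B y := by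
    intro y
    simp only [A, B, m]
    rw [sum_logRatio_midpoint, le_div_iff₀ (by positivity)]
    linarith
  have hpt : ∀ y, ENNReal.ofReal ((a - b) ^ 2 / 4) ≤
      ENNReal.ofReal (Real.exp (A y)) * ENNReal.ofReal ((t y - a) ^ 2) +
      ENNReal.ofReal (Real.exp (B y)) * ENNReal.ofReal ((t y - b) ^ 2) +
      ENNReal.ofReal ((a - b) ^ 2 / 16) *
        (ENNReal.ofReal (Real.exp (A y)) + ENNReal.ofReal (Real.exp (B y))) := by
    intro y
    rw [← ENNReal.ofReal_mul (by positivity), ← ENNReal.ofReal_mul (by positivity),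
      ← ENNReal.ofReal_add (by positivity) (by positivity),
      ← ENNReal.ofReal_add (by positivity) (by positivity), ← ENNReal.ofReal_mul (by positivity),
      ← ENNReal.ofReal_add (by positivity) (by positivity)]
    refine ENNReal.ofReal_le_ofReal ((two_point_pointwise (t := t y) (hAB y)).trans (le_of_eq ?_))
    ring
  have hint := lintegral_mono (μ := dataLaw σ m) hpt
  rw [lintegral_const, measure_univ, mul_one, lintegral_add_left (by fun_prop), lintegral_add_left (by fun_prop), lintegral_const_mul _ (by fun_prop), lintegral_add_left hA,
    hA1, hB1] at hint
  rw [hdA, hdB, lintegral_withDensity_eq_lintegral_mul _ hA hta,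
    lintegral_withDensity_eq_lintegral_mul _ hB htb]
  have h8 : ENNReal.ofReal ((a - b) ^ 2 / 16) * (1 + 1) = ENNReal.ofReal ((a - b) ^ 2 / 8) := by
    rw [one_add_one_eq_two, ← ENNReal.ofReal_ofNat 2, ← ENNReal.ofReal_mul (by positivity)]
    congr 1; ring
  have h4 : ENNReal.ofReal ((a - b) ^ 2 / 4) =
      ENNReal.ofReal ((a - b) ^ 2 / 8) + ENNReal.ofReal ((a - b) ^ 2 / 8) := by
    rw [← ENNReal.ofReal_add (by positivity) (by positivity)]; congr 1; ring
  rw [h8, h4] at hint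
  -- Both densities integrate to `1`, so the remainder term is exactly `(a - b) ^ 2 / 8` and cancels
  -- half of `(a - b) ^ 2 / 4`.
  exact (ENNReal.add_le_add_iff_right ENNReal.ofReal_ne_top).1 hint

/-- The sign attached to a Boolean. -/
def boolSign (b : Bool) : ℝ := if b then 1 else -1

/-- Assouad's hypercube bound along orthonormal directions. -/
lemma minimaxRisk_ge_of_hypercube [DecidableEq ι] [Nonempty ι] {σ : ℝ≥0} (hσ : 0 < σ)
    {K : Set (ι → ℝ)} {v : ι → ι → ℝ} (hv : ∀ i j, v i ⬝ᵥ v j = if i = j then 1 else 0)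
    (S : Finset ι) (δ : ℝ) (hδ : δ ^ 2 ≤ (σ : ℝ) ^ 2)
    (hK : ∀ ε : ι → Bool, combination v (fun i => if i ∈ S then δ * boolSign (ε i) else 0) ∈ K) :
    ENNReal.ofReal (δ ^ 2 / 4 * S.card / Fintype.card ι) ≤ minimaxRisk σ K := by
  refine le_iInf₂ fun est hest => ?_
  let θ : (ι → Bool) → ι → ℝ :=
    fun ε => combination v (fun i => if i ∈ S then δ * boolSign (ε i) else 0)
  have hcoef : ∀ ε i, v i ⬝ᵥ θ ε = if i ∈ S then δ * boolSign (ε i) else 0 :=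
    fun ε i => dotProduct_combination hv _ i
  let E : (ι → Bool) → ι → ℝ≥0∞ := fun ε i =>
    ∫⁻ y, ENNReal.ofReal ((v i ⬝ᵥ est y - δ * boolSign (ε i)) ^ 2) ∂(dataLaw σ (θ ε))
  have hmeas : ∀ i, Measurable fun y => v i ⬝ᵥ est y := by
    intro i
    unfold dotProduct
    fun_prop
  have hcard : (Fintype.card ι : ℝ≥0∞) ≠ 0 := by simp
  have hupper : ∀ ε, ∑ i ∈ S, E ε i ≤ maxRisk σ K est * Fintype.card ι := by
    intro ε
    have h1 : (∫⁻ y, ENNReal.ofReal (‖WithLp.toLp 2 (est y - θ ε)‖ ^ 2) ∂(dataLaw σ (θ ε))) /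
        (Fintype.card ι : ℝ≥0∞) ≤ maxRisk σ K est :=
      le_iSup₂ (f := fun θ (_ : θ ∈ K) =>
        (∫⁻ y, ENNReal.ofReal (‖WithLp.toLp 2 (est y - θ)‖ ^ 2) ∂(dataLaw σ θ)) /
          (Fintype.card ι : ℝ≥0∞)) (θ ε) (hK ε)
    rw [ENNReal.div_le_iff hcard (ENNReal.natCast_ne_top _)] at h1
    refine le_trans ?_ h1
    rw [← lintegral_finsetSum _ fun i _ => by have := hmeas i; fun_prop]
    refine lintegral_mono fun y => ?_
    dsimp only
    rw [← ENNReal.ofReal_sum_of_nonneg fun _ _ => sq_nonneg _]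
    refine ENNReal.ofReal_le_ofReal ?_
    rw [norm_toLp_sq, dotProduct_eq_sum_of_orthonormal hv]
    refine (Finset.sum_le_sum fun i hi => ?_).trans (Finset.sum_le_sum_of_subset_of_nonneg
      (Finset.subset_univ S) fun i _ _ => mul_self_nonneg _)
    rw [dotProduct_sub, hcoef, if_pos hi, sq]
  -- Flipping sign `i` pairs the vertices; signs are indexed by all of `ι`, those outside `S` being
  -- dummies.
  let flip : ι → (ι → Bool) → (ι → Bool) := fun i ε => Function.update ε i (!ε i)
  have hflip : ∀ i, Function.Involutive (flip i) := by
    intro i ε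
    simp [flip]
  -- Paired vertices differ by `2δ` along `v i` alone, so their squared distance `4 * δ ^ 2` is
  -- within reach of the two-point bound.
  have hpair : ∀ i ∈ S, ∀ ε, ENNReal.ofReal (δ ^ 2 / 2) ≤ E ε i + E (flip i ε) i := by
    intro i hi ε
    have hd : (θ ε - θ (flip i ε)) ⬝ᵥ (θ ε - θ (flip i ε)) ≤ 4 * (σ : ℝ) ^ 2 := by
      rw [dotProduct_eq_sum_of_orthonormal hv, Finset.sum_eq_single i]
      · rw [dotProduct_sub, hcoef, hcoef, if_pos hi, if_pos hi]
        simp only [flip, Function.update_self]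
        cases ε i <;> simp [boolSign] <;> nlinarith
      · intro j _ hj
        rw [dotProduct_sub, hcoef, hcoef]
        simp [flip, Function.update_of_ne hj]
      · simp
    refine le_trans (le_of_eq ?_) (two_point_lower_bound hσ hd (hmeas i) (δ * boolSign (ε i))
      (δ * boolSign (flip i ε i)))
    congr 1
    simp only [flip, Function.update_self]
    cases ε i <;> simp [boolSign] <;> ring
  have hsum : ∀ i ∈ S, (2 : ℝ≥0∞) ^ Fintype.card ι * ENNReal.ofReal (δ ^ 2 / 4) ≤ ∑ ε, E ε i := by
    intro i hi
    have h1 : ∑ ε, E (flip i ε) i = ∑ ε, E ε i :=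
      Equiv.sum_comp (hflip i).toPerm fun ε => E ε i
    have h2 : ∑ _ε : ι → Bool, ENNReal.ofReal (δ ^ 2 / 2) ≤ ∑ ε, (E ε i + E (flip i ε) i) :=
      Finset.sum_le_sum fun ε _ => hpair i hi ε
    rw [Finset.sum_add_distrib, h1, ← two_mul, Finset.sum_const, nsmul_eq_mul] at h2
    have h3 : ENNReal.ofReal (δ ^ 2 / 2) = 2 * ENNReal.ofReal (δ ^ 2 / 4) := by
      rw [← ENNReal.ofReal_ofNat 2, ← ENNReal.ofReal_mul (by positivity)]
      congr 1; ring
    rw [h3, mul_left_comm] at h2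
    have h4 := (ENNReal.mul_le_mul_iff_right two_ne_zero ENNReal.ofNat_ne_top).1 h2
    simpa using h4
  have htotal : (2 : ℝ≥0∞) ^ Fintype.card ι * (S.card * ENNReal.ofReal (δ ^ 2 / 4)) ≤
      (2 : ℝ≥0∞) ^ Fintype.card ι * (maxRisk σ K est * Fintype.card ι) := by
    calc (2 : ℝ≥0∞) ^ Fintype.card ι * (S.card * ENNReal.ofReal (δ ^ 2 / 4))
        = ∑ i ∈ S, (2 : ℝ≥0∞) ^ Fintype.card ι * ENNReal.ofReal (δ ^ 2 / 4) := by
          rw [Finset.sum_const, nsmul_eq_mul]; ring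
      _ ≤ ∑ i ∈ S, ∑ ε, E ε i := Finset.sum_le_sum hsum
      _ = ∑ ε, ∑ i ∈ S, E ε i := Finset.sum_comm
      _ ≤ ∑ _ε : ι → Bool, maxRisk σ K est * Fintype.card ι :=
          Finset.sum_le_sum fun ε _ => hupper ε
      _ = _ := by simp
  have h5 := (ENNReal.mul_le_mul_iff_right (by simp) (by simp)).1 htotal
  rw [← ENNReal.div_le_iff hcard (ENNReal.natCast_ne_top _)] at h5
  refine le_trans (le_of_eq ?_) h5
  rw [ENNReal.ofReal_div_of_pos (by exact_mod_cast Fintype.card_pos), mul_comm (δ ^ 2 / 4),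
    ENNReal.ofReal_mul (by positivity), ENNReal.ofReal_natCast, ENNReal.ofReal_natCast]

/-! ### Upper bound: the risk of projections -/

lemma lintegral_linear_sq (σ : ℝ≥0) (θ u : ι → ℝ) :
    ∫⁻ y, ENNReal.ofReal ((u ⬝ᵥ y - u ⬝ᵥ θ) ^ 2) ∂(dataLaw σ θ) =
      ENNReal.ofReal ((σ : ℝ) ^ 2 * (u ⬝ᵥ u)) := by
  have hL : ∀ x, MemLp (fun z : ℝ => u x * z) 2 (gaussianReal (θ x) (σ ^ 2)) := fun x =>
    (memLp_id_gaussianReal' 2 (by simp)).const_mul (u x)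
  have hL' : ∀ x, MemLp (fun y : ι → ℝ => u x * y x) 2 (dataLaw σ θ) := fun x =>
    (hL x).comp_measurePreserving (measurePreserving_eval _ x)
  have hX : (fun y : ι → ℝ => u ⬝ᵥ y) = ∑ x, fun y : ι → ℝ => u x * y x := by
    ext y; simp [dotProduct]
  have hmem : MemLp (fun y : ι → ℝ => u ⬝ᵥ y) 2 (dataLaw σ θ) := by
    rw [hX]; exact memLp_finsetSum' _ fun x _ => hL' x
  have hmean : (dataLaw σ θ)[fun y : ι → ℝ => u ⬝ᵥ y] = u ⬝ᵥ θ := by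
    simp only [dotProduct]
    rw [integral_finsetSum _ fun x _ => (hL' x).integrable (by norm_num)]
    refine Finset.sum_congr rfl fun x _ => ?_
    rw [integral_const_mul]
    have := integral_comp_eval (μ := fun x => gaussianReal (θ x) (σ ^ 2)) (i := x) (f := id)
      aestronglyMeasurable_id
    simp only [id] at this
    rw [dataLaw, this, integral_id_gaussianReal]
  have hvar : Var[fun y : ι → ℝ => u ⬝ᵥ y; dataLaw σ θ] = (σ : ℝ) ^ 2 * (u ⬝ᵥ u) := by
    rw [hX, dataLaw, variance_sum_pi (X := fun x z => u x * z) hL, dotProduct, Finset.mul_sum]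
    refine Finset.sum_congr rfl fun x _ => ?_
    rw [variance_const_mul, variance_fun_id_gaussianReal]
    push_cast; ring
  rw [← hvar, hmem.ofReal_variance_eq, evariance_eq_lintegral_ofReal, hmean]

end Gaussian

lemma dotProduct_eigenmaps {d N : ℕ} {v : Lattice d N → Lattice d N → ℝ}
    (hv : ∀ i j, v i ⬝ᵥ v j = if i = j then 1 else 0) (Q : Finset (Lattice d N))
    (y : Lattice d N → ℝ) (i : Lattice d N) :
    v i ⬝ᵥ eigenmaps v Q y = if i ∈ Q then v i ⬝ᵥ y else 0 := by
  rw [← dotProduct_combination hv (fun i => if i ∈ Q then v i ⬝ᵥ y else 0) i]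
  congr 1
  ext x
  rw [eigenmaps, ← Matrix.mulVec_mulVec, combination]
  simp only [Matrix.mulVec, dotProduct, eigenmapsMatrix, Matrix.of_apply, Matrix.transpose_apply,
    Finset.sum_apply, Pi.smul_apply, ite_smul, zero_smul, smul_eq_mul, ite_apply, Pi.zero_apply,
    Finset.sum_ite_mem, Finset.univ_inter]
  rw [Finset.univ_eq_attach, Finset.sum_attach Q (fun i => v i x * ∑ z, v i z * y z)]
  exact Finset.sum_congr rfl fun i _ => mul_comm _ _

lemma measurable_eigenmaps {d N : ℕ} (v : Lattice d N → Lattice d N → ℝ)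
    (Q : Finset (Lattice d N)) : Measurable (eigenmaps v Q) := by
  unfold eigenmaps Matrix.mulVec dotProduct
  fun_prop

/-- By Parseval the loss splits into noise on `Q`, of variance `σ ^ 2` per unit direction, and the
discarded coefficients of `θ`. -/
lemma maxRisk_eigenmaps_le {d N : ℕ} (hN : 1 ≤ N) (σ : ℝ≥0) {K : Set (Lattice d N → ℝ)}
    {v : Lattice d N → Lattice d N → ℝ} (hv : ∀ i j, v i ⬝ᵥ v j = if i = j then 1 else 0)
    (Q : Finset (Lattice d N)) (b : ℝ) (hb : ∀ θ ∈ K, ∑ i ∈ Qᶜ, (v i ⬝ᵥ θ) ^ 2 ≤ b) :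
    maxRisk σ K (eigenmaps v Q) ≤
      ENNReal.ofReal (((σ : ℝ) ^ 2 * Q.card + b) / sampleSize d N) := by
  refine iSup₂_le fun θ hθ => ?_
  have hcard : ENNReal.ofReal (sampleSize d N) = (Fintype.card (Lattice d N) : ℝ≥0∞) := by
    rw [sampleSize, ← Nat.cast_pow, ENNReal.ofReal_natCast]; simp
  have hn : 0 < sampleSize d N := by
    have : (0 : ℝ) < N := by exact_mod_cast hN
    rw [sampleSize]; positivity
  rw [ENNReal.ofReal_div_of_pos hn, hcard]
  refine ENNReal.div_le_div_right ?_ _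
  have hb0 : 0 ≤ ∑ i ∈ Qᶜ, (v i ⬝ᵥ θ) ^ 2 := Finset.sum_nonneg fun _ _ => sq_nonneg _
  have hnorm : ∀ y, ENNReal.ofReal (‖WithLp.toLp 2 (eigenmaps v Q y - θ)‖ ^ 2) =
      ∑ i ∈ Q, ENNReal.ofReal ((v i ⬝ᵥ y - v i ⬝ᵥ θ) ^ 2) +
        ENNReal.ofReal (∑ i ∈ Qᶜ, (v i ⬝ᵥ θ) ^ 2) := by
    intro y
    rw [← ENNReal.ofReal_sum_of_nonneg fun _ _ => sq_nonneg _,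
      ← ENNReal.ofReal_add (Finset.sum_nonneg fun _ _ => sq_nonneg _) hb0, norm_toLp_sq,
      dotProduct_eq_sum_of_orthonormal hv, ← Finset.sum_add_sum_compl Q]
    congr 2
    · refine Finset.sum_congr rfl fun i hi => ?_
      rw [dotProduct_sub, dotProduct_eigenmaps hv, if_pos hi, sq]
    · refine Finset.sum_congr rfl fun i hi => ?_
      rw [dotProduct_sub, dotProduct_eigenmaps hv, if_neg (Finset.mem_compl.1 hi)]
      ring
  have hmeas : ∀ i, Measurable fun y => v i ⬝ᵥ y := by
    intro i
    unfold dotProduct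
    fun_prop
  simp_rw [hnorm]
  rw [lintegral_add_right _ measurable_const, lintegral_const, measure_univ, mul_one,
    lintegral_finsetSum _ fun i _ => by have := hmeas i; fun_prop]
  simp_rw [lintegral_linear_sq, hv, if_true, mul_one]
  rw [Finset.sum_const, nsmul_eq_mul, ENNReal.ofReal_add (by positivity) (hb0.trans (hb θ hθ)),
    mul_comm ((σ : ℝ) ^ 2), ENNReal.ofReal_mul (by positivity), ENNReal.ofReal_natCast]
  gcongr
  exact hb θ hθ

/-! ### Rates -/

lemma sampleSize_pos {d N : ℕ} (hN : 1 ≤ N) : 0 < sampleSize d N := by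
  have : (0 : ℝ) < N := by exact_mod_cast hN
  rw [sampleSize]; positivity

lemma one_le_sampleSize {d N : ℕ} (hN : 1 ≤ N) : 1 ≤ sampleSize d N :=
  one_le_pow₀ (by exact_mod_cast hN)

lemma effSmooth_pos {d : ℕ} (k : ℕ) (hd : 1 ≤ d) : 0 < effSmooth d k := by
  have : (0 : ℝ) < d := by exact_mod_cast hd
  rw [effSmooth]; positivity

lemma pow_rpow_two_mul_effSmooth {d : ℕ} (k : ℕ) (hd : 1 ≤ d) {x : ℝ} (hx : 0 ≤ x) :
    (x ^ d) ^ (2 * effSmooth d k) = x ^ (2 * (k + 1)) := by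
  have hd0 : (d : ℝ) ≠ 0 := by exact_mod_cast (by omega : d ≠ 0)
  rw [← Real.rpow_natCast, ← Real.rpow_natCast, ← Real.rpow_mul hx]
  congr 1
  rw [effSmooth]
  push_cast
  field_simp

lemma cutoffSize_nonneg (d k N : ℕ) (B : ℝ) : 0 ≤ cutoffSize d k N B := by
  unfold cutoffSize sampleSize; positivity

lemma cutoffSize_rpow {d k N : ℕ} (hd : 1 ≤ d) (B : ℝ) :
    cutoffSize d k N B ^ (2 * effSmooth d k + 1) =
      B ^ 2 * sampleSize d N ^ (2 * effSmooth d k) := by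
  have := effSmooth_pos k hd
  rw [cutoffSize, one_div, Real.rpow_inv_rpow _ (by positivity)]
  unfold sampleSize; positivity

lemma cutoffSize_eq {d k N : ℕ} (hd : 1 ≤ d) (hN : 1 ≤ N) (B : ℝ) :
    cutoffSize d k N B = sampleSize d N *
      (B ^ 2 / sampleSize d N) ^ (1 / (2 * effSmooth d k + 1)) := by
  have hs := effSmooth_pos k hd
  have hn := sampleSize_pos (d := d) hN
  have h1 : B ^ 2 * sampleSize d N ^ (2 * effSmooth d k) =
      sampleSize d N ^ (2 * effSmooth d k + 1) * (B ^ 2 / sampleSize d N) := by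
    rw [Real.rpow_add_one hn.ne']; field_simp
  rw [cutoffSize, h1, Real.mul_rpow (by positivity) (by positivity), one_div,
    Real.rpow_rpow_inv hn.le (by positivity)]

/-- After this both risk bounds amount to comparing a number of directions, `τ ^ d` or `M ^ d`, with
`1 + T`. -/
lemma sobolevRate_eq {d k N : ℕ} (hd : 1 ≤ d) (hN : 1 ≤ N) (B : ℝ) :
    sobolevRate d k N B = (1 + cutoffSize d k N B) / sampleSize d N := by
  have hn := sampleSize_pos (d := d) hN
  rw [cutoffSize_eq hd hN, sobolevRate]
  field_simp

lemma cutoffSize_le_sampleSize {d k N : ℕ} (hd : 1 ≤ d) (hN : 1 ≤ N) {B : ℝ} (hB : 0 < B)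
    (hBn : B ≤ √(sampleSize d N)) : cutoffSize d k N B ≤ sampleSize d N := by
  have hs := effSmooth_pos k hd
  have hn := sampleSize_pos (d := d) hN
  rw [cutoffSize_eq hd hN]
  refine mul_le_of_le_one_right hn.le (Real.rpow_le_one (by positivity) ?_ (by positivity))
  rw [div_le_one hn]
  exact (Real.le_sqrt hB.le hn.le).1 hBn

/-- The `d`-th root of the cutoff size. -/
lemma exists_root_cutoffSize {d : ℕ} (k N : ℕ) (hd : 1 ≤ d) (B : ℝ) :
    ∃ r : ℝ, 0 ≤ r ∧ r ^ d = cutoffSize d k N B :=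
  ⟨cutoffSize d k N B ^ (d : ℝ)⁻¹, Real.rpow_nonneg (cutoffSize_nonneg _ _ _ _) _,
    Real.rpow_inv_natCast_pow (cutoffSize_nonneg _ _ _ _) (by omega)⟩

lemma card_cube {d N τ : ℕ} (hτ : τ ≤ N) : (cube d N τ).card = τ ^ d := by
  have h : cube d N τ = Fintype.piFinset fun _ : Fin d => Finset.univ.filter fun i : Fin N =>
      (i : ℕ) < τ := by
    ext i; simp [cube]
  rw [h, Fintype.card_piFinset]
  simp [Fin.card_filter_val_lt, hτ]

/-! ### Risk bounds over the Sobolev class. -/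

lemma mem_sobolevClass_iff {d k N : ℕ} {B : ℝ} (hB : 0 ≤ B) {θ : Lattice d N → ℝ} :
    θ ∈ sobolevClass d k N B ↔ (kronMat d k N *ᵥ θ) ⬝ᵥ (kronMat d k N *ᵥ θ) ≤ B ^ 2 := by
  rw [← norm_toLp_sq, pow_le_pow_iff_left₀ (norm_nonneg _) hB two_ne_zero]
  rfl

/-- An index outside the cube has some coordinate at least `τ` (counted from zero), so `ξ i ^ 2 ≥
ζ_τ ^ 2 ≥ κ` and the squared bias is at most `B ^ 2 / κ`. Substituting `B ^ 2 * N ^ (2 * (k + 1)) =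
T ^ (2 * s + 1)` and `τ ^ d ≥ c₁ * (1 + T)` leaves a multiple of `1 + T`. -/
lemma exists_maxRisk_eigenmaps_le (d k : ℕ) (hd : 1 ≤ d) (σ : ℝ≥0) (hσ : 0 < σ) (c₁ c₂ : ℝ)
    (hc₁ : 0 < c₁) (hc₂ : 0 < c₂) : ∃ C : ℝ, 0 < C ∧ ∀ (N : ℕ) (B : ℝ), 1 ≤ N → 0 < B →
      ∀ (τ : ℕ) (ξ : Lattice d N → ℝ) (v : Lattice d N → Lattice d N → ℝ),
        IsCutoff d k N B c₁ c₂ τ → IsEigenmapsSystem d k N ξ v →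
          maxRisk σ (sobolevClass d k N B) (eigenmaps v (cube d N τ)) ≤
            ENNReal.ofReal (C * sobolevRate d k N B) := by
  have hσ' : (0 : ℝ) < σ := hσ
  set s := effSmooth d k with hs
  have hs0 : 0 < s := effSmooth_pos k hd
  refine ⟨(σ : ℝ) ^ 2 * c₂ + (4 * (k + 1 : ℕ)) ^ (2 * (k + 1)) / c₁ ^ (2 * s), by positivity,
    fun N B hN hB τ ξ v hτ hsys => ?_⟩
  obtain ⟨ζ, w, hw, hζ, hξ⟩ := hsys.sorted
  have hN0 : (0 : ℝ) < N := by exact_mod_cast hN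
  have hτ1 : 1 ≤ τ := le_trans (by omega) hτ.null_le
  have hτ0 : (0 : ℝ) < τ := by exact_mod_cast hτ1
  set κ : ℝ := ((τ : ℝ) / (4 * (k + 1 : ℕ) * N)) ^ (2 * (k + 1)) with hκ
  have hκ0 : 0 < κ := by positivity
  have hξκ : ∀ i ∈ (cube d N τ)ᶜ, κ ≤ ξ i ^ 2 := by
    intro i hi
    simp only [cube, Finset.mem_compl, Finset.mem_filter, Finset.mem_univ, true_and, not_forall,
      not_lt] at hi
    obtain ⟨j, hj⟩ := hi
    have hτN : τ < N := hj.trans_lt (i j).2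
    -- An index outside the cube forces `τ < N`, so `null_le` reads `k + 1 ≤ τ`, as the singular
    -- value bound requires.
    have h1 := singularValue_diffMat_lower (Nat.succ_pos k) hw hζ ⟨τ, hτN⟩
      (by have := hτ.null_le; simp only; omega)
    have h2 : ζ ⟨τ, hτN⟩ ≤ ζ (i j) := hζ (Fin.mk_le_of_le_val hj)
    have h3 := hw.nonneg ⟨τ, hτN⟩
    rw [hξ, Real.sq_sqrt (Finset.sum_nonneg fun _ _ => sq_nonneg _)]
    calc κ ≤ ζ ⟨τ, hτN⟩ ^ 2 := h1
      _ ≤ ζ (i j) ^ 2 := by gcongr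
      _ ≤ _ := Finset.single_le_sum (f := fun j => ζ (i j) ^ 2) (fun _ _ => sq_nonneg _)
          (Finset.mem_univ j)
  refine (maxRisk_eigenmaps_le hN σ hsys.system.orthonormal (cube d N τ) (B ^ 2 / κ)
    fun θ hθ => ?_).trans (ENNReal.ofReal_le_ofReal ?_)
  · rw [mem_sobolevClass_iff hB.le, hsys.system.mulVec_dotProduct_self] at hθ
    rw [le_div_iff₀ hκ0, mul_comm, Finset.mul_sum]
    refine le_trans ?_ hθ
    refine (Finset.sum_le_sum fun i hi => ?_).trans (Finset.sum_le_sum_of_subset_of_nonneg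
      (Finset.subset_univ _) fun i _ _ => by positivity)
    exact mul_le_mul_of_nonneg_right (hξκ i hi) (sq_nonneg _)
  · rw [sobolevRate_eq hd hN, ← mul_div_assoc]
    refine div_le_div_of_nonneg_right ?_ (sampleSize_pos hN).le
    rw [card_cube hτ.le_size, add_mul]
    push_cast
    set T := cutoffSize d k N B with hT
    have hT0 : 0 ≤ T := cutoffSize_nonneg _ _ _ _
    have hvar : (σ : ℝ) ^ 2 * τ ^ d ≤ σ ^ 2 * c₂ * (1 + T) := by
      rw [mul_assoc]
      exact mul_le_mul_of_nonneg_left hτ.upper (by positivity)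
    have hτd : ((τ : ℝ) ^ d) ^ (2 * s) = (τ : ℝ) ^ (2 * (k + 1)) :=
      pow_rpow_two_mul_effSmooth k hd hτ0.le
    have hNd : sampleSize d N ^ (2 * s) = (N : ℝ) ^ (2 * (k + 1)) :=
      pow_rpow_two_mul_effSmooth k hd hN0.le
    have hTr : T ^ (2 * s + 1) = B ^ 2 * (N : ℝ) ^ (2 * (k + 1)) := by
      rw [← hNd]; exact cutoffSize_rpow hd B
    have h1 : T ^ (2 * s + 1) ≤ (1 + T) ^ (2 * s) * (1 + T) := by
      rw [← Real.rpow_add_one (by positivity)]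
      exact Real.rpow_le_rpow hT0 (by linarith) (by positivity)
    have h2 : c₁ ^ (2 * s) * (1 + T) ^ (2 * s) ≤ (τ : ℝ) ^ (2 * (k + 1)) := by
      rw [← Real.mul_rpow hc₁.le (by positivity), ← hτd]
      exact Real.rpow_le_rpow (by positivity) hτ.lower (by positivity)
    have hbias : B ^ 2 / κ ≤
        (4 * (k + 1 : ℕ)) ^ (2 * (k + 1)) / c₁ ^ (2 * s) * (1 + T) := by
      have hc : 0 < c₁ ^ (2 * s) := by positivity
      have hκ' : B ^ 2 / κ =
          (4 * (k + 1 : ℕ)) ^ (2 * (k + 1)) * (T ^ (2 * s + 1) / (τ : ℝ) ^ (2 * (k + 1))) := by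
        rw [hTr, hκ, div_pow, mul_pow]
        field_simp
      rw [hκ', div_mul_eq_mul_div, mul_div_assoc]
      refine mul_le_mul_of_nonneg_left ?_ (by positivity)
      rw [div_le_div_iff₀ (by positivity) hc]
      calc T ^ (2 * s + 1) * c₁ ^ (2 * s)
          ≤ (1 + T) ^ (2 * s) * (1 + T) * c₁ ^ (2 * s) := by gcongr
        _ = (1 + T) * (c₁ ^ (2 * s) * (1 + T) ^ (2 * s)) := by ring
        _ ≤ (1 + T) * (τ : ℝ) ^ (2 * (k + 1)) := by gcongr
    push_cast at hbias
    linarith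

lemma exists_isCutoff {d k N : ℕ} (hd : 1 ≤ d) (hN : 1 ≤ N) {B : ℝ} (hB : 0 < B)
    (hBn : B ≤ √(sampleSize d N)) :
    ∃ τ, IsCutoff d k N B (1 / 2) (((k : ℝ) + 2) ^ d) τ := by
  obtain ⟨r, hr0, hr⟩ := exists_root_cutoffSize k N hd B
  have hTn := cutoffSize_le_sampleSize (k := k) hd hN hB hBn
  -- This `τ` is at least `1` and at least `r` (as `r ≤ N`), so `τ ^ d` dominates the average of `1`
  -- and `r ^ d`: hence the constant `1 / 2`. From above it is at most `(k + 2) * max 1 r`.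
  refine ⟨min N (max (k + 1) ⌈r⌉₊), min_le_left _ _, by omega, ?_, ?_⟩
  · rw [← hr] at hTn ⊢
    have hrN : r ≤ N := by
      rw [sampleSize] at hTn
      exact (pow_le_pow_iff_left₀ hr0 (by positivity) (by omega)).1 hTn
    have h1 : (1 : ℝ) ≤ (min N (max (k + 1) ⌈r⌉₊) : ℕ) := by exact_mod_cast (by omega)
    have h2 : r ≤ (min N (max (k + 1) ⌈r⌉₊) : ℕ) := by
      rw [Nat.cast_min, Nat.cast_max]
      exact le_min hrN ((Nat.le_ceil r).trans (le_max_right _ _))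
    have h3 := pow_le_pow_left₀ hr0 h2 d
    have h4 := one_le_pow₀ h1 (n := d)
    linarith
  · rw [← hr]
    have h1 : ((min N (max (k + 1) ⌈r⌉₊) : ℕ) : ℝ) ≤ (k + 2) * max 1 r := by
      rw [Nat.cast_min, Nat.cast_max]
      refine (min_le_right _ _).trans (max_le ?_ ?_)
      · push_cast
        nlinarith [le_max_left 1 r, (Nat.cast_nonneg k : (0 : ℝ) ≤ k)]
      · have := Nat.ceil_lt_add_one hr0
        nlinarith [le_max_left 1 r, le_max_right 1 r, (Nat.cast_nonneg k : (0 : ℝ) ≤ k)]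
    refine (pow_le_pow_left₀ (by positivity) h1 d).trans ?_
    rw [mul_pow]
    refine mul_le_mul_of_nonneg_left ?_ (by positivity)
    have hrd : 0 ≤ r ^ d := by positivity
    rcases max_cases 1 r with ⟨h, _⟩ | ⟨h, _⟩ <;> rw [h]
    · rw [one_pow]; linarith
    · linarith

/-- Every vertex of the hypercube with amplitude `σ` on `[M]^d` has energy at most `σ ^ 2 * M ^ d *
(d * z)`, since each `ξ i ^ 2` is a sum of `d` terms bounded by `z`. -/
lemma minimaxRisk_sobolevClass_ge {d k N M : ℕ} (hN : 1 ≤ N) {σ : ℝ≥0} (hσ : 0 < σ) {B : ℝ}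
    (hB : 0 < B) (hM : M ≤ N) {ζ : Fin N → ℝ} {w : Fin N → Fin N → ℝ}
    (hw : IsRightSingularSystem (diffMat N (k + 1)) ζ w) (hζ : Monotone ζ) (z : ℝ)
    (hz : ∀ t : Fin N, (t : ℕ) < M → ζ t ^ 2 ≤ z) (hzB : (σ : ℝ) ^ 2 * M ^ d * (d * z) ≤ B ^ 2) :
    ENNReal.ofReal ((σ : ℝ) ^ 2 / 4 * M ^ d / sampleSize d N) ≤
      minimaxRisk σ (sobolevClass d k N B) := by
  have hsys := hw.isEigenmapsSystem (d := d) hζ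
  have hn : Nonempty (Fin N) := ⟨⟨0, hN⟩⟩
  have := minimaxRisk_ge_of_hypercube hσ (K := sobolevClass d k N B) hsys.system.orthonormal
    (cube d N M) σ le_rfl fun ε => ?_
  · refine le_trans (le_of_eq ?_) this
    rw [card_cube hM]
    simp [sampleSize]
  · rw [mem_sobolevClass_iff hB.le, hsys.system.mulVec_dotProduct_self]
    simp_rw [dotProduct_combination hsys.system.orthonormal]
    refine le_trans ?_ hzB
    calc _ = ∑ i ∈ cube d N M, √(∑ j, ζ (i j) ^ 2) ^ 2 * (σ : ℝ) ^ 2 := by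
          rw [← Finset.sum_subset (Finset.subset_univ (cube d N M))]
          · refine Finset.sum_congr rfl fun i hi => ?_
            rw [if_pos hi]
            cases ε i <;> simp [boolSign]
          · intro i _ hi
            simp [hi]
      _ ≤ ∑ _i ∈ cube d N M, d * z * (σ : ℝ) ^ 2 := by
          refine Finset.sum_le_sum fun i hi => mul_le_mul_of_nonneg_right ?_ (sq_nonneg _)
          rw [Real.sq_sqrt (Finset.sum_nonneg fun _ _ => sq_nonneg _)]
          refine (Finset.sum_le_card_nsmul _ _ z fun j _ => hz _ ?_).trans (by simp)
          exact (Finset.mem_filter.1 hi).2 j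
      _ = _ := by
          rw [Finset.sum_const, card_cube hM, nsmul_eq_mul]
          push_cast; ring

lemma exists_minimaxRisk_ge (d k : ℕ) (hd : 1 ≤ d) (σ : ℝ≥0) (hσ : 0 < σ) :
    ∃ c : ℝ, 0 < c ∧ ∀ (N : ℕ) (B : ℝ), 1 ≤ N → 0 < B → B ≤ √(sampleSize d N) →
      ENNReal.ofReal (c * sobolevRate d k N B) ≤ minimaxRisk σ (sobolevClass d k N B) := by
  have hσ' : (0 : ℝ) < σ := hσ
  obtain ⟨C, hC, hup⟩ := exists_singularValue_diffMat_le (k + 1)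
  set A : ℝ := (σ : ℝ) ^ 2 * d * C with hA
  have hA0 : 0 ≤ A := by positivity
  -- The first bound on `κ` keeps `M ≤ κ * r` in the range where the singular value estimate of
  -- order `k + 1` applies; the second makes the hypercube fit in the class.
  set κ : ℝ := min (1 / (8 * ((k : ℝ) + 2))) (1 / (A + 1)) with hκ
  have hκ0 : 0 < κ := by positivity
  have hκ1 : κ * (8 * ((k : ℝ) + 2)) ≤ 1 := by
    rw [← le_div_iff₀ (by positivity)]; exact min_le_left _ _
  have hκA : A * κ ≤ 1 := by
    have : κ * (A + 1) ≤ 1 := by rw [← le_div_iff₀ (by positivity)]; exact min_le_right _ _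
    linarith
  have hκle : κ ≤ 1 := by nlinarith [(Nat.cast_nonneg k : (0 : ℝ) ≤ k)]
  have hκd : (κ / 2) ^ d ≤ 1 := pow_le_one₀ (by positivity) (by linarith)
  refine ⟨(σ : ℝ) ^ 2 / 4 * ((κ / 2) ^ d / 2), by positivity, fun N B hN hB hBn => ?_⟩
  obtain ⟨ζ, w, hw, hζ⟩ := exists_isRightSingularSystem_monotone (diffMat N (k + 1))
  obtain ⟨r, hr0, hr⟩ := exists_root_cutoffSize k N hd B
  have hN0 : (0 : ℝ) < N := by exact_mod_cast hN
  have hTn := cutoffSize_le_sampleSize (k := k) hd hN hB hBn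
  have hrN : r ≤ N := by
    rw [← hr, sampleSize] at hTn
    exact (pow_le_pow_iff_left₀ hr0 (by positivity) (by omega)).1 hTn
  have hrB : r ^ d * r ^ (2 * (k + 1)) = B ^ 2 * (N : ℝ) ^ (2 * (k + 1)) := by
    have h1 := cutoffSize_rpow (k := k) (N := N) hd B
    rw [← hr, sampleSize, pow_rpow_two_mul_effSmooth k hd hN0.le] at h1
    rw [← h1, ← pow_rpow_two_mul_effSmooth k hd hr0, mul_comm]
    have hs := effSmooth_pos k hd
    rw [Real.rpow_add_of_nonneg (by positivity) (by positivity) zero_le_one, Real.rpow_one]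
  suffices h : ∃ M : ℕ, M ≤ N ∧ (κ / 2) ^ d / 2 * (1 + r ^ d) ≤ (M : ℝ) ^ d ∧ ∃ z : ℝ,
      (∀ t : Fin N, (t : ℕ) < M → ζ t ^ 2 ≤ z) ∧ (σ : ℝ) ^ 2 * M ^ d * (d * z) ≤ B ^ 2 by
    obtain ⟨M, hM, hMr, z, hz, hzB⟩ := h
    refine le_trans (ENNReal.ofReal_le_ofReal ?_)
      (minimaxRisk_sobolevClass_ge hN hσ hB hM hw hζ z hz hzB)
    rw [sobolevRate_eq hd hN, ← hr, ← mul_div_assoc, mul_assoc]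
    exact div_le_div_of_nonneg_right (mul_le_mul_of_nonneg_left hMr (by positivity))
      (sampleSize_pos hN).le
  -- If `κ * r < 1`, use the single index whose singular value is zero: a direction the class does
  -- not constrain. Otherwise `M = ⌊κ * r⌋₊` is at least `κ * r / 2`. Either way `M ^ d` dominates
  -- both `1` and `(κ / 2) ^ d * r ^ d`.
  rcases lt_or_ge (κ * r) 1 with hκr | hκr
  · refine ⟨1, hN, ?_, 0, fun t ht => ?_, by simpa using sq_nonneg B⟩
    · have h1 : (κ / 2) ^ d * r ^ d ≤ 1 := by
        rw [← mul_pow]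
        exact pow_le_one₀ (by positivity) (by nlinarith)
      simp only [Nat.cast_one, one_pow]
      linarith
    · rw [singularValue_diffMat_zero (Nat.succ_pos k) hw hζ t (by omega)]; simp
  · set M : ℕ := ⌊κ * r⌋₊ with hM
    have hMle : (M : ℝ) ≤ κ * r := Nat.floor_le (by positivity)
    have hM1 : 1 ≤ M := Nat.one_le_floor_iff _ |>.2 hκr
    have hMlt : κ * r < M + 1 := Nat.lt_floor_add_one _
    have hM1' : (1 : ℝ) ≤ M := by exact_mod_cast hM1
    have hMN8 : 8 * ((k + 1 : ℕ) + 1) * M ≤ N := by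
      have : (8 : ℝ) * ((k + 1 : ℕ) + 1) * M ≤ N := by
        push_cast
        calc 8 * ((k : ℝ) + 1 + 1) * M ≤ 8 * ((k : ℝ) + 1 + 1) * (κ * r) := by gcongr
          _ = (κ * (8 * ((k : ℝ) + 2))) * r := by ring
          _ ≤ 1 * N := by gcongr
          _ = N := one_mul _
      exact_mod_cast this
    refine ⟨M, by nlinarith, ?_, C * ((M : ℝ) / N) ^ (2 * (k + 1)), fun t ht => ?_, ?_⟩
    · have h1 : (κ / 2) ^ d * r ^ d ≤ (M : ℝ) ^ d := by
        rw [← mul_pow]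
        exact pow_le_pow_left₀ (by positivity) (by linarith) d
      have h2 := one_le_pow₀ hM1' (n := d)
      linarith
    · have ht' : (t : ℕ) + 1 ≤ M := ht
      refine (hup N ζ w hw hζ t (le_trans (Nat.mul_le_mul_left _ ht') hMN8)).trans ?_
      have : ((t : ℕ) : ℝ) + 1 ≤ M := by exact_mod_cast ht'
      gcongr
    · have h1 : (M : ℝ) ^ d * (M : ℝ) ^ (2 * (k + 1)) ≤
          κ * (B ^ 2 * (N : ℝ) ^ (2 * (k + 1))) := by
        rw [← hrB, ← pow_add, ← pow_add]
        refine (pow_le_pow_left₀ (by positivity) hMle _).trans ?_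
        rw [mul_pow]
        -- Of the factor `κ ^ (d + 2 * (k + 1))` only one power of `κ` is kept, enough to absorb
        -- `A`.
        exact mul_le_mul_of_nonneg_right (pow_le_of_le_one hκ0.le hκle (by omega))
          (by positivity)
      calc (σ : ℝ) ^ 2 * M ^ d * (d * (C * ((M : ℝ) / N) ^ (2 * (k + 1))))
          = A * ((M : ℝ) ^ d * (M : ℝ) ^ (2 * (k + 1))) / (N : ℝ) ^ (2 * (k + 1)) := by
            rw [hA, div_pow]; ring
        _ ≤ A * (κ * (B ^ 2 * (N : ℝ) ^ (2 * (k + 1)))) / (N : ℝ) ^ (2 * (k + 1)) := by gcongr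
        _ = A * κ * B ^ 2 := by field_simp
        _ ≤ 1 * B ^ 2 := by gcongr
        _ = B ^ 2 := one_mul _

lemma minimaxRisk_le_maxRisk_eigenmaps {d N : ℕ} (σ : ℝ≥0) (K : Set (Lattice d N → ℝ))
    (v : Lattice d N → Lattice d N → ℝ) (Q : Finset (Lattice d N)) :
    minimaxRisk σ K ≤ maxRisk σ K (eigenmaps v Q) :=
  iInf₂_le _ (measurable_eigenmaps v Q)

lemma exists_minimaxRisk_le (d k : ℕ) (hd : 1 ≤ d) (σ : ℝ≥0) (hσ : 0 < σ) :
    ∃ C : ℝ, 0 < C ∧ ∀ (N : ℕ) (B : ℝ), 1 ≤ N → 0 < B → B ≤ √(sampleSize d N) →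
      minimaxRisk σ (sobolevClass d k N B) ≤ ENNReal.ofReal (C * sobolevRate d k N B) := by
  obtain ⟨C, hC, h⟩ := exists_maxRisk_eigenmaps_le d k hd σ hσ (1 / 2) (((k : ℝ) + 2) ^ d)
    (by norm_num) (by positivity)
  refine ⟨C, hC, fun N B hN hB hBn => ?_⟩
  obtain ⟨τ, hτ⟩ := exists_isCutoff (k := k) hd hN hB hBn
  obtain ⟨ζ, w, hw, hζ⟩ := exists_isRightSingularSystem_monotone (diffMat N (k + 1))
  exact (minimaxRisk_le_maxRisk_eigenmaps σ _ _ _).trans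
    (h N B hN hB τ _ _ hτ (hw.isEigenmapsSystem hζ))

/-! ### The canonical scaling. -/

/-- Projecting on all directions leaves the data unchanged, with risk `σ ^ 2`; this covers radii
above `√n`. -/
lemma minimaxRisk_le_variance {d k N : ℕ} (hN : 1 ≤ N) (σ : ℝ≥0) (K : Set (Lattice d N → ℝ)) :
    minimaxRisk σ K ≤ ENNReal.ofReal ((σ : ℝ) ^ 2) := by
  obtain ⟨ζ, w, hw, hζ⟩ := exists_isRightSingularSystem_monotone (diffMat N (k + 1))
  refine (minimaxRisk_le_maxRisk_eigenmaps σ K _ _).trans ((maxRisk_eigenmaps_le hN σ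
    (hw.isEigenmapsSystem (d := d) hζ).system.orthonormal Finset.univ 0
    fun θ _ => by simp).trans (le_of_eq ?_))
  have hn := sampleSize_pos (d := d) hN
  have : ((Finset.univ : Finset (Lattice d N)).card : ℝ) = sampleSize d N := by
    simp [sampleSize]
  rw [this, add_zero, mul_div_cancel_right₀ _ hn.ne']

lemma minimaxRisk_mono {ι : Type*} [Fintype ι] (σ : ℝ≥0) {K K' : Set (ι → ℝ)} (h : K ⊆ K') :
    minimaxRisk σ K ≤ minimaxRisk σ K' :=
  iInf₂_mono fun _ _ => biSup_mono h

/-- The rate term at a radius `x n^(1/2-s)`. -/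
lemma rate_canonical {s n x : ℝ} (hn : 0 < n) :
    ((x * n ^ (1 / 2 - s)) ^ 2 / n) ^ (1 / (2 * s + 1)) =
      (x ^ 2) ^ (1 / (2 * s + 1)) * n ^ (-(2 * s) / (2 * s + 1)) := by
  have h1 : (x * n ^ (1 / 2 - s)) ^ 2 / n = x ^ 2 * n ^ (-(2 * s)) := by
    rw [mul_pow, mul_div_assoc, ← Real.rpow_mul_natCast hn.le]
    congr 1
    rw [div_eq_iff hn.ne', ← Real.rpow_add_one hn.ne']
    congr 1
    push_cast
    ring
  rw [h1, Real.mul_rpow (by positivity) (by positivity), ← Real.rpow_mul hn.le]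
  congr 2
  ring

lemma exists_minimaxRisk_canonical (d k : ℕ) (hd : 1 ≤ d) (σ : ℝ≥0) (hσ : 0 < σ) (a b : ℝ)
    (ha : 0 < a) (hb : 0 < b) : ∃ c C : ℝ, 0 < c ∧ 0 < C ∧ ∀ (N : ℕ) (B : ℝ), 1 ≤ N →
      a * sampleSize d N ^ (1 / 2 - effSmooth d k) ≤ B →
      B ≤ b * sampleSize d N ^ (1 / 2 - effSmooth d k) →
        ENNReal.ofReal (c * sampleSize d N ^
            (-(2 * effSmooth d k) / (2 * effSmooth d k + 1))) ≤
            minimaxRisk σ (sobolevClass d k N B) ∧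
          minimaxRisk σ (sobolevClass d k N B) ≤
            ENNReal.ofReal (C * sampleSize d N ^
              (-(2 * effSmooth d k) / (2 * effSmooth d k + 1))) := by
  have hσ' : (0 : ℝ) < σ := hσ
  obtain ⟨c, hc, hlow⟩ := exists_minimaxRisk_ge d k hd σ hσ
  obtain ⟨C, hC, hup⟩ := exists_minimaxRisk_le d k hd σ hσ
  set s := effSmooth d k with hs
  have hs0 : 0 < s := effSmooth_pos k hd
  refine ⟨c * ((min a 1) ^ 2) ^ (1 / (2 * s + 1)),
    C * (1 + (b ^ 2) ^ (1 / (2 * s + 1))) + (σ : ℝ) ^ 2 * b ^ 2, by positivity, by positivity,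
    fun N B hN haB hBb => ?_⟩
  set n := sampleSize d N with hn
  have hn1 : 1 ≤ n := one_le_sampleSize hN
  have hn0 : 0 < n := sampleSize_pos hN
  have hB : 0 < B := lt_of_lt_of_le (by positivity) haB
  constructor
  · have hB' : 0 < min B (√n) := lt_min hB (Real.sqrt_pos.2 hn0)
    have hsub : sobolevClass d k N (min B (√n)) ⊆ sobolevClass d k N B :=
      Set.ofPred_subset_ofPred.2 fun θ hθ => le_trans hθ (min_le_left _ _)
    refine le_trans (ENNReal.ofReal_le_ofReal ?_) ((hlow N _ hN hB' (min_le_right _ _)).trans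
      (minimaxRisk_mono σ hsub))
    have h1 : min a 1 * n ^ (1 / 2 - s) ≤ min B (√n) := by
      refine le_min (le_trans ?_ haB) ?_
      · exact mul_le_mul_of_nonneg_right (min_le_left _ _) (by positivity)
      · rw [Real.sqrt_eq_rpow]
        refine (mul_le_of_le_one_left (by positivity) (min_le_right _ _)).trans ?_
        exact Real.rpow_le_rpow_of_exponent_le hn1 (by linarith)
    rw [mul_assoc, ← rate_canonical hn0, sobolevRate]
    refine mul_le_mul_of_nonneg_left (le_add_of_nonneg_of_le (by positivity) ?_) hc.le
    gcongr
  · rcases le_or_gt B (√n) with hBn | hBn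
    · refine (hup N B hN hB hBn).trans (ENNReal.ofReal_le_ofReal ?_)
      have h1 : 1 / n ≤ n ^ (-(2 * s) / (2 * s + 1)) := by
        rw [one_div, ← Real.rpow_neg_one]
        refine Real.rpow_le_rpow_of_exponent_le hn1 ?_
        rw [le_div_iff₀ (by positivity)]
        linarith
      have h2 : (B ^ 2 / n) ^ (1 / (2 * s + 1)) ≤
          (b ^ 2) ^ (1 / (2 * s + 1)) * n ^ (-(2 * s) / (2 * s + 1)) := by
        rw [← rate_canonical hn0]
        gcongr
      have h3 : sobolevRate d k N B ≤
          (1 + (b ^ 2) ^ (1 / (2 * s + 1))) * n ^ (-(2 * s) / (2 * s + 1)) := by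
        rw [sobolevRate]; linarith
      calc C * sobolevRate d k N B
          ≤ C * ((1 + (b ^ 2) ^ (1 / (2 * s + 1))) * n ^ (-(2 * s) / (2 * s + 1))) := by gcongr
        _ = C * (1 + (b ^ 2) ^ (1 / (2 * s + 1))) * n ^ (-(2 * s) / (2 * s + 1)) := by ring
        _ ≤ _ := by gcongr; exact le_add_of_nonneg_right (by positivity)
    · refine (minimaxRisk_le_variance (k := k) hN σ _).trans (ENNReal.ofReal_le_ofReal ?_)
      -- Exceeding `√n` while obeying the canonical upper bound forces `n ^ s ≤ b`: the target rate
      -- is then bounded below, and the constant risk `σ ^ 2` is of its order.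
      have h1 : n ^ s ≤ b := by
        have h2 := (hBn.trans_le hBb).le
        rw [Real.sqrt_eq_rpow, Real.rpow_sub hn0, mul_div_assoc', le_div_iff₀ (by positivity),
          mul_comm] at h2
        exact le_of_mul_le_mul_right h2 (by positivity)
      have h2 : n ^ (2 * s / (2 * s + 1)) ≤ b ^ 2 := by
        calc n ^ (2 * s / (2 * s + 1)) ≤ n ^ (s * (2 : ℕ)) := by
              refine Real.rpow_le_rpow_of_exponent_le hn1 ?_
              rw [div_le_iff₀ (by positivity)]
              push_cast
              nlinarith
          _ = (n ^ s) ^ 2 := Real.rpow_mul_natCast hn0.le _ _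
          _ ≤ b ^ 2 := by gcongr
      have h3 : 1 ≤ b ^ 2 * n ^ (-(2 * s) / (2 * s + 1)) := by
        rw [neg_div, Real.rpow_neg hn0.le, ← div_eq_mul_inv, le_div_iff₀ (by positivity), one_mul]
        exact h2
      calc (σ : ℝ) ^ 2 = (σ : ℝ) ^ 2 * 1 := (mul_one _).symm
        _ ≤ (σ : ℝ) ^ 2 * (b ^ 2 * n ^ (-(2 * s) / (2 * s + 1))) := by gcongr
        _ = (σ : ℝ) ^ 2 * b ^ 2 * n ^ (-(2 * s) / (2 * s + 1)) := by ring
        _ ≤ _ := by gcongr; exact le_add_of_nonneg_left (by positivity)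

end KroneckerTF

end

theorem theorem5 (d k : ℕ) (hd : 1 ≤ d) (σ : ℝ≥0) (hσ : 0 < σ) :
    -- the minimax rate, uniformly over all radii `0 < B ≤ √n`
    (∃ c C : ℝ, 0 < c ∧ 0 < C ∧ ∀ (N : ℕ) (B : ℝ), 1 ≤ N → 0 < B →
      B ≤ √(KroneckerTF.sampleSize d N) →
        ENNReal.ofReal (c * KroneckerTF.sobolevRate d k N B) ≤
            KroneckerTF.minimaxRisk σ (KroneckerTF.sobolevClass d k N B) ∧
          KroneckerTF.minimaxRisk σ (KroneckerTF.sobolevClass d k N B) ≤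
            ENNReal.ofReal (C * KroneckerTF.sobolevRate d k N B)) ∧
    -- every eigenmaps projection estimator with an admissible cutoff attains this rate
    (∀ c₁ c₂ : ℝ, 0 < c₁ → 0 < c₂ → ∃ C : ℝ, 0 < C ∧ ∀ (N : ℕ) (B : ℝ), 1 ≤ N → 0 < B →
      B ≤ √(KroneckerTF.sampleSize d N) →
        ∀ (τ : ℕ) (ξ : KroneckerTF.Lattice d N → ℝ)
          (v : KroneckerTF.Lattice d N → KroneckerTF.Lattice d N → ℝ),
          KroneckerTF.IsCutoff d k N B c₁ c₂ τ → KroneckerTF.IsEigenmapsSystem d k N ξ v →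
            KroneckerTF.maxRisk σ (KroneckerTF.sobolevClass d k N B)
                (KroneckerTF.eigenmaps v (KroneckerTF.cube d N τ)) ≤
              ENNReal.ofReal (C * KroneckerTF.sobolevRate d k N B)) ∧
    -- such estimators exist for all sizes and radii, with the same two constants
    (∃ c₁ c₂ : ℝ, 0 < c₁ ∧ 0 < c₂ ∧ ∀ (N : ℕ) (B : ℝ), 1 ≤ N → 0 < B →
      B ≤ √(KroneckerTF.sampleSize d N) →
        ∃ (τ : ℕ) (ξ : KroneckerTF.Lattice d N → ℝ)
          (v : KroneckerTF.Lattice d N → KroneckerTF.Lattice d N → ℝ),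
          KroneckerTF.IsCutoff d k N B c₁ c₂ τ ∧ KroneckerTF.IsEigenmapsSystem d k N ξ v) ∧
    -- the rate under the canonical scaling `B ≍ n^(1/2 - s)`
    (∀ a b : ℝ, 0 < a → 0 < b → ∃ c C : ℝ, 0 < c ∧ 0 < C ∧ ∀ (N : ℕ) (B : ℝ), 1 ≤ N →
      a * KroneckerTF.sampleSize d N ^ (1 / 2 - KroneckerTF.effSmooth d k) ≤ B →
      B ≤ b * KroneckerTF.sampleSize d N ^ (1 / 2 - KroneckerTF.effSmooth d k) →
        ENNReal.ofReal (c * KroneckerTF.sampleSize d N ^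
            (-(2 * KroneckerTF.effSmooth d k) / (2 * KroneckerTF.effSmooth d k + 1))) ≤
            KroneckerTF.minimaxRisk σ (KroneckerTF.sobolevClass d k N B) ∧
          KroneckerTF.minimaxRisk σ (KroneckerTF.sobolevClass d k N B) ≤
            ENNReal.ofReal (C * KroneckerTF.sampleSize d N ^
              (-(2 * KroneckerTF.effSmooth d k) / (2 * KroneckerTF.effSmooth d k + 1)))) := by
  refine ⟨?_, ?_, ?_, KroneckerTF.exists_minimaxRisk_canonical d k hd σ hσ⟩
  · obtain ⟨c, hc, hlow⟩ := KroneckerTF.exists_minimaxRisk_ge d k hd σ hσ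
    obtain ⟨C, hC, hup⟩ := KroneckerTF.exists_minimaxRisk_le d k hd σ hσ
    exact ⟨c, C, hc, hC, fun N B hN hB hBn => ⟨hlow N B hN hB hBn, hup N B hN hB hBn⟩⟩
  · intro c₁ c₂ hc₁ hc₂
    obtain ⟨C, hC, h⟩ := KroneckerTF.exists_maxRisk_eigenmaps_le d k hd σ hσ c₁ c₂ hc₁ hc₂
    exact ⟨C, hC, fun N B hN hB _ => h N B hN hB⟩
  · refine ⟨1 / 2, ((k : ℝ) + 2) ^ d, by norm_num, by positivity, fun N B hN hB hBn => ?_⟩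
    obtain ⟨τ, hτ⟩ := KroneckerTF.exists_isCutoff (k := k) hd hN hB hBn
    obtain ⟨ζ, w, hw, hζ⟩ :=
      KroneckerTF.exists_isRightSingularSystem_monotone (KroneckerTF.diffMat N (k + 1))
    exact ⟨τ, _, _, hτ, hw.isEigenmapsSystem hζ⟩
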